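/- **Setting.** Let $Q=(Q_0,Q_1)$ be a finite quiver, $k=\mathbb F_q$ a finite field, and $W=\sum_u a_u u$ a potential, i.e. a finite $k$-linear combination of cycles (closed paths of positive length). Let $Q_2$ be the set of cycles with $a_u\neq 0$. Let $\mathrm{wt}:Q_1\to\mathbb N$ be a weight function that is positive on all cycles and such that all cycles $u\in Q_2$ have the same weight $d=\mathrm{wt}(W)$ (if $W=0$, $d$ is arbitrary). Let $\Lambda$ be the pushout of the maps $\mathbb Z^{Q_2}\to\mathbb Z^{Q_1}$ (content of a cycle) and $\mathbb Z^{Q_2}\to\mathbb Z$ ($u\mapsto 1$), and assume that the canonical map $\omega:\mathbb Z\to\Lambda$ is a split monomorphism. For a finite-dimensional representation $M$ of $Q$ over $k$ put $w(M)=\sum_u a_u\operatorname{tr}(M_u)$, and for $t\in k^*$ let $tM$ be the representation with $(tM)_a=t^{\mathrm{wt}(a)}M_a$. Let $\chi(\alpha,\beta)=\sum_i\alpha_i\beta_i-\sum_{a:i\to j}\alpha_i\beta_j$, $\langle\alpha,\beta\rangle=\chi(\alpha,\beta)-\chi(\beta,\alpha)$ and $T(\alpha)=\chi(\alpha,\alpha)$.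 For $\theta\in\mathbb R^{Q_0}$ and $0\ne\alpha\in\mathbb N^{Q_0}$ let $\mu_\theta(\alpha)=\theta\cdot\alpha/\sum_i\alpha_i$; $M$ is $\theta$-semistable if $\mu_\theta(\underline{\dim}\,N)\le\mu_\theta(\underline{\dim}\,M)$ for all subrepresentations $0\ne N\subsetneq M$. Let $\widehat H$ be the completed Hall algebra: the $\mathbb Q(q^{1/2})$-vector space of all formal sums $\sum a_M[M]$ over isomorphism classes of finite-dimensional representations of $Q$ over $k$, with $$[N]\circ[M]=\sum_{[X]}\#\{U\subset X : U\simeq N,\ X/U\simeq M\}\,[X].$$ Let $\widehat H_{\rm eq}\subset\widehat H$ consist of the elements with $a_{tM}=a_M$ for all $t\in k^*$. Let $A_q=\mathbb Q(q^{1/2})[[x_i]]_{i\in Q_0}$ be the quantum torus, with $x^\alpha\circ x^\beta=(-q^{1/2})^{\langle\alpha,\beta\rangle}x^{\alpha+\beta}$. Define $$I:\widehat H\to A_q,\quad [M]\mapsto\frac{(-q^{1/2})^{T(\underline{\dim}\,M)}}{\#\operatorname{Aut}M}\,x^{\underline{\dim}\,M},\qquad I_{\rm eq}:\widehat H_{\rm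 eq}\to A_q,\quad I_{\rm eq}(f)=\frac{I(f)-q\,I(f_0)}{1-q},$$ where $f_0=\sum_{w(M)=0}a_M[M]$ for $f=\sum a_M[M]$. For $\mu\in\mathbb R$ let $$\widetilde A^\theta_\mu=\sum_{M}[M]\in\widehat H_{\rm eq},\qquad A^\theta_\mu=I_{\rm eq}(\widetilde A^\theta_\mu)\in A_q,$$ where the sum runs over the isomorphism classes of $\theta$-semistable representations of slope $\mu$, the zero representation being counted for every $\mu$. Put $\widetilde A=\widetilde A^0_0$ (the sum of all isomorphism classes) and $A=A^0_0$. **Theorem (Harder–Narasimhan relation).** For every $\theta\in\mathbb R^{Q_0}$, $$A=\prod^{\leftarrow}_{\mu\in\mathbb R}A^\theta_\mu\ \text{ in } A_q,\qquad\text{and}\qquad \widetilde A=\prod^{\leftarrow}_{\mu\in\mathbb R}\widetilde A^\theta_\mu\ \text{ in }\widehat H_{\rm eq},$$ where the products are taken in decreasing order of $\mu$ (the factor with the largest $\mu$ is leftmost); this means that in each degree $\alpha\in\mathbb N^{Q_0}$ the component of the ordered product over a finite set $S\subset\mathbb R$ equals the component of the left-hand side for all sufficiently large $S$. Moreover, if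 $\gcd(d,q-1)=1$, then $\widehat H_{\rm eq}$ contains $1$ and is closed under multiplication, and $I_{\rm eq}:\widehat H_{\rm eq}\to A_q$ is a homomorphism of unital algebras. -/

import Mathlib

universe u v w

noncomputable section

namespace QuiverDT



/-! ### Quivers, Euler form, slopes -/

section Combinatorics

variable {V : Type u} [Quiver.{v} V]

/-- The set of all arrows of the quiver. -/
abbrev Arrow (V : Type u) [Quiver.{v} V] : Type (max u v) := Σ i j : V, (i ⟶ j)

/-- The Euler–Ringel form `χ(α, β) = ∑ᵢ αᵢ βᵢ - ∑_{a : i → j} αᵢ βⱼ` on `ℤ^{Q₀}`. -/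
def eulerForm [Fintype V] [∀ i j : V, Fintype (i ⟶ j)] (α β : V → ℤ) : ℤ :=
  ∑ i, α i * β i - ∑ i, ∑ j, ∑ _ : i ⟶ j, α i * β j

/-- The skew-symmetric form `⟨α, β⟩ = χ(α, β) - χ(β, α)`. -/
def skewForm [Fintype V] [∀ i j : V, Fintype (i ⟶ j)] (α β : V → ℤ) : ℤ :=
  eulerForm α β - eulerForm β α

/-- The Tits form `T(α) = χ(α, α)`. -/
def titsForm [Fintype V] [∀ i j : V, Fintype (i ⟶ j)] (α : V → ℤ) : ℤ :=
  eulerForm α α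

/-- A dimension vector regarded as an element of `ℤ^{Q₀}`. -/
def toInt (α : V → ℕ) : V → ℤ := fun i => (α i : ℤ)

/-- The slope `μ_θ(α) = θ · α / ∑ αᵢ`, used for `α ≠ 0` only. -/
def slope [Fintype V] (θ : V → ℝ) (α : V → ℕ) : ℝ :=
  (∑ i, θ i * (α i : ℝ)) / ∑ i, (α i : ℝ)

/-- A cycle: a closed path of positive length (with a chosen base point). -/
structure Cycle (V : Type u) [Quiver.{v} V] where
  base : V
  path : Quiver.Path base base
  length_pos : 0 < path.length

/-- The weight of a path: the sum of the weights of its arrows. -/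
def pathWeight (wt : Arrow V → ℕ) {i : V} : ∀ {j : V}, Quiver.Path i j → ℕ
  | _, .nil => 0
  | _, .cons p a => pathWeight wt p + wt ⟨_, _, a⟩

/-- The content of a path: each arrow is counted as often as it occurs. -/
def content {i : V} : ∀ {j : V}, Quiver.Path i j → (Arrow V →₀ ℤ)
  | _, .nil => 0
  | _, .cons p a => content p + Finsupp.single ⟨_, _, a⟩ 1

/-- A potential `W = ∑ a_u u`: a finite linear combination of cycles. -/
abbrev Potential (k : Type w) [Field k] (V : Type u) [Quiver.{v} V] := Cycle V →₀ k

variable {k : Type w} [Field k]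

/-- The weight function is positive on all cycles. -/
def PositiveOnCycles (wt : Arrow V → ℕ) : Prop :=
  ∀ u : Cycle V, 0 < pathWeight wt u.path

/-- `W` is homogeneous of weight `d`: all cycles occurring in `W` have weight `d`. -/
def IsHomogeneous (W : Potential k V) (wt : Arrow V → ℕ) (d : ℕ) : Prop :=
  ∀ u ∈ W.support, pathWeight wt u.path = d

/-- The relations `(content u, -1)`, for the cycles `u` occurring in `W`, which define the pushout
of `ℤ^{Q₁} ← ℤ^{Q₂} → ℤ`. -/
def pushoutRelations (W : Potential k V) : AddSubgroup ((Arrow V →₀ ℤ) × ℤ) :=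
  AddSubgroup.closure {x | ∃ u ∈ W.support, x = (content u.path, -1)}

/-- The pushout `Λ` of the maps `ℤ^{Q₂} → ℤ^{Q₁}` (content) and `ℤ^{Q₂} → ℤ` (each cycle goes
to `1`), where `Q₂` is the set of cycles occurring in `W`. -/
abbrev Lambda (W : Potential k V) := ((Arrow V →₀ ℤ) × ℤ) ⧸ pushoutRelations W

/-- The canonical map `ω : ℤ → Λ`. -/
def omega (W : Potential k V) : ℤ →+ Lambda W :=
  (QuotientAddGroup.mk' (pushoutRelations W)).comp (AddMonoidHom.inr (Arrow V →₀ ℤ) ℤ)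

/-- `ω : ℤ → Λ` is a split monomorphism. -/
def IsPrimitive (W : Potential k V) : Prop :=
  ∃ ρ : Lambda W →+ ℤ, ρ.comp (omega W) = AddMonoidHom.id ℤ

end Combinatorics

/-! ### Representations -/

section Representations

variable {V : Type u} [Quiver.{v} V] {k : Type w} [Field k]

/-- A representation of the quiver on a given family of vector spaces. -/
abbrev QRep (k : Type w) [Field k] {V : Type u} [Quiver.{v} V] (E : V → Type w)
    [∀ i, AddCommGroup (E i)] [∀ i, Module k (E i)] :=
  ∀ ⦃i j : V⦄, (i ⟶ j) → (E i →ₗ[k] E j)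

variable {E : V → Type w} [∀ i, AddCommGroup (E i)] [∀ i, Module k (E i)]
variable {E' : V → Type w} [∀ i, AddCommGroup (E' i)] [∀ i, Module k (E' i)]
variable {E'' : V → Type w} [∀ i, AddCommGroup (E'' i)] [∀ i, Module k (E'' i)]

/-- An isomorphism of representations. -/
@[ext]
structure RepIso (M : QRep k E) (N : QRep k E') where
  map : ∀ i, E i ≃ₗ[k] E' i
  comm : ∀ ⦃i j : V⦄ (a : i ⟶ j) (x : E i), map j (M a x) = N a (map i x)

/-- The identity isomorphism. -/
def RepIso.refl (M : QRep k E) : RepIso M M where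
  map i := LinearEquiv.refl k (E i)
  comm _ _ _ _ := rfl

/-- The inverse isomorphism. -/
def RepIso.symm {M : QRep k E} {N : QRep k E'} (g : RepIso M N) : RepIso N M where
  map i := (g.map i).symm
  comm i j a x := by
    rw [LinearEquiv.symm_apply_eq, g.comm, LinearEquiv.apply_symm_apply]

/-- The composition of isomorphisms. -/
def RepIso.trans {M : QRep k E} {N : QRep k E'} {L : QRep k E''}
    (g : RepIso M N) (h : RepIso N L) : RepIso M L where
  map i := (g.map i).trans (h.map i)
  comm i j a x := by simp [g.comm, h.comm]

/-- A subrepresentation. -/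
structure SubRep (M : QRep k E) where
  space : ∀ i, Submodule k (E i)
  map_mem : ∀ ⦃i j : V⦄ (a : i ⟶ j), ∀ x ∈ space i, M a x ∈ space j

/-- A subrepresentation, as a representation. -/
def SubRep.rep {M : QRep k E} (U : SubRep M) : QRep k (fun i => U.space i) :=
  fun _ _ a => (M a).restrict (U.map_mem a)

/-- The quotient by a subrepresentation. -/
def SubRep.quot {M : QRep k E} (U : SubRep M) : QRep k (fun i => E i ⧸ U.space i) :=
  fun i j a => (U.space i).mapQ (U.space j) (M a) (U.map_mem a)

/-- `M` is `θ`-semistable: `μ_θ(N) ≤ μ_θ(M)` for all subrepresentations `0 ≠ N ⊊ M`. In particular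
the zero representation is semistable. -/
def IsSemistable [Fintype V] (θ : V → ℝ) (M : QRep k E) : Prop :=
  ∀ U : SubRep M, (∃ i, U.space i ≠ ⊥) → (∃ i, U.space i ≠ ⊤) →
    slope θ (fun i => Module.finrank k (U.space i)) ≤ slope θ (fun i => Module.finrank k (E i))

/-- The linear map `M_u` attached to a path `u`. -/
def pathMap (M : QRep k E) {i : V} : ∀ {j : V}, Quiver.Path i j → (E i →ₗ[k] E j)
  | _, .nil => LinearMap.id
  | _, .cons p a => (M a).comp (pathMap M p)

/-- The trace of the potential, `w(M) = ∑ a_u tr(M_u)`. -/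
def traceW (W : Potential k V) (M : QRep k E) : k :=
  W.sum fun u c => c * LinearMap.trace k (E u.base) (pathMap M u.path)

/-- The representation `tM`, with `(tM)_a = t^{wt(a)} M_a`. -/
def scale (wt : Arrow V → ℕ) (t : kˣ) (M : QRep k E) : QRep k E :=
  fun i j a => ((t : k) ^ wt ⟨i, j, a⟩) • M a

/-! Invariance under isomorphism -/

lemma pathMap_comm {M : QRep k E} {N : QRep k E'} (g : RepIso M N) {i j : V}
    (p : Quiver.Path i j) (x : E i) : g.map j (pathMap M p x) = pathMap N p (g.map i x) := by
  induction p with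
  | nil => rfl
  | cons p a ih => simp [pathMap, g.comm, ih]

lemma traceW_congr (W : Potential k V) {M : QRep k E} {N : QRep k E'} (g : RepIso M N) :
    traceW W M = traceW W N := by
  unfold traceW
  refine Finsupp.sum_congr fun u _ => ?_
  have h : pathMap N u.path = (g.map u.base).conj (pathMap M u.path) := by
    ext x
    simp [LinearEquiv.conj_apply, pathMap_comm g]
  rw [h, LinearMap.trace_conj']

/-- The image of a subrepresentation under an isomorphism. -/
def SubRep.image {M : QRep k E} {N : QRep k E'} (g : RepIso M N) (U : SubRep M) : SubRep N where
  space i := (U.space i).map (g.map i : E i →ₗ[k] E' i)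
  map_mem i j a x hx := by
    obtain ⟨y, hy, rfl⟩ := hx
    exact ⟨M a y, U.map_mem a y hy, g.comm a y⟩

lemma IsSemistable.congr [Fintype V] {θ : V → ℝ} {M : QRep k E} {N : QRep k E'} (g : RepIso M N)
    (h : IsSemistable θ N) : IsSemistable θ M := by
  intro U hb ht
  have h1 := h (U.image g) ?_ ?_
  · have e1 : (fun i => Module.finrank k ((U.image g).space i)) =
        fun i => Module.finrank k (U.space i) := by
      funext i
      exact LinearEquiv.finrank_map_eq (g.map i) (U.space i)
    have e2 : (fun i => Module.finrank k (E' i)) = fun i => Module.finrank k (E i) := by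
      funext i
      exact (g.map i).finrank_eq.symm
    rwa [e1, e2] at h1
  · obtain ⟨i, hi⟩ := hb
    refine ⟨i, fun h0 => hi ?_⟩
    simpa [SubRep.image] using h0
  · obtain ⟨i, hi⟩ := ht
    refine ⟨i, fun h0 => hi ?_⟩
    simpa [SubRep.image] using h0

lemma isSemistable_scale [Fintype V] (θ : V → ℝ) (wt : Arrow V → ℕ) (t : kˣ) (M : QRep k E) :
    IsSemistable θ (scale wt t M) ↔ IsSemistable θ M := by
  constructor
  · intro h U
    exact h ⟨U.space, fun i j a x hx => Submodule.smul_mem _ _ (U.map_mem a x hx)⟩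
  · intro h U
    refine h ⟨U.space, fun i j a x hx => ?_⟩
    have h1 := U.map_mem a x hx
    have h2 : (t : k) ^ wt ⟨i, j, a⟩ ≠ 0 := pow_ne_zero _ t.ne_zero
    exact (Submodule.smul_mem_iff _ h2).1 h1

/-- An isomorphism `M ≅ N`, as an isomorphism `tM ≅ tN`. -/
def RepIso.scale {M : QRep k E} {N : QRep k E'} (g : RepIso M N) (wt : Arrow V → ℕ) (t : kˣ) :
    RepIso (scale wt t M) (QuiverDT.scale wt t N) where
  map := g.map
  comm i j a x := by simp [QuiverDT.scale, g.comm]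

/-! ### Isomorphism classes -/

variable (k) in
/-- The space of representations `R(Q, α)`. -/
abbrev RepSpace (α : V → ℕ) := QRep k (fun i : V => Fin (α i) → k)

variable (k) in
/-- Isomorphism is an equivalence relation on `R(Q, α)`. -/
def isoSetoid (α : V → ℕ) : Setoid (RepSpace k α) where
  r M N := Nonempty (RepIso M N)
  iseqv := ⟨fun M => ⟨RepIso.refl M⟩, fun ⟨g⟩ => ⟨g.symm⟩, fun ⟨g⟩ ⟨h⟩ => ⟨g.trans h⟩⟩

variable (k) in
/-- The isomorphism classes of representations of dimension vector `α`. -/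
def IsoClass (α : V → ℕ) := Quotient (isoSetoid k α)

/-- A representative of an isomorphism class. -/
def IsoClass.rep {α : V → ℕ} (X : IsoClass k α) : RepSpace k α := Quotient.out X

/-- The function `w` on isomorphism classes. -/
def IsoClass.w (W : Potential k V) {α : V → ℕ} (X : IsoClass k α) : k :=
  Quotient.lift (traceW W) (fun _ _ h => Nonempty.elim h fun g => traceW_congr W g) X

/-- The action of `k^*` on isomorphism classes, `[M] ↦ [tM]`. -/
def IsoClass.scale (wt : Arrow V → ℕ) (t : kˣ) {α : V → ℕ} (X : IsoClass k α) : IsoClass k α :=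
  Quotient.map (QuiverDT.scale wt t) (fun _ _ h => Nonempty.elim h fun g => ⟨g.scale wt t⟩) X

/-- Semistability of isomorphism classes. -/
def IsoClass.Semistable [Fintype V] (θ : V → ℝ) {α : V → ℕ} (X : IsoClass k α) : Prop :=
  Quotient.lift (IsSemistable θ)
    (fun _ _ e => Nonempty.elim e fun g => propext ⟨fun h => h.congr g.symm, fun h => h.congr g⟩) X

lemma IsoClass.semistable_scale [Fintype V] (θ : V → ℝ) (wt : Arrow V → ℕ) (t : kˣ) {α : V → ℕ}
    (X : IsoClass k α) : (X.scale wt t).Semistable θ ↔ X.Semistable θ := by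
  induction X using Quotient.inductionOn with
  | h M => exact isSemistable_scale θ wt t M

/-- The order of the automorphism group of (a representative of) an isomorphism class. -/
def IsoClass.cardAut {α : V → ℕ} (X : IsoClass k α) : ℕ := Nat.card (RepIso X.rep X.rep)

/-- The structure constant `F_{MN}^X = #{U ⊆ X | U ≅ N, X/U ≅ M}`. -/
def hallNumber {α β γ : V → ℕ} (M : IsoClass k γ) (N : IsoClass k β) (X : IsoClass k α) : ℕ :=
  Nat.card {U : SubRep X.rep // Nonempty (RepIso U.rep N.rep) ∧ Nonempty (RepIso U.quot M.rep)}

instance [Finite V] [∀ i j : V, Finite (i ⟶ j)] [Finite k] (α : V → ℕ) :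
    Finite (IsoClass k α) := by
  have h (i j : V) : Finite ((Fin (α i) → k) →ₗ[k] (Fin (α j) → k)) := DFunLike.finite _
  unfold IsoClass RepSpace QRep
  infer_instance

instance [Finite V] [∀ i j : V, Finite (i ⟶ j)] [Finite k] (α : V → ℕ) :
    Fintype (IsoClass k α) := Fintype.ofFinite _

end Representations

/-! ### The completed Hall algebra and the quantum torus -/

section Algebras

/-- The field `ℚ(q^{1/2})`, where `q` is the number of elements of `k`. -/
abbrev Coeff (k : Type w) : Type := IntermediateField.adjoin ℚ {Real.sqrt (Nat.card k : ℝ)}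

/-- The element `q^{1/2}` of `ℚ(q^{1/2})`. -/
def sqrtq (k : Type w) : Coeff k :=
  IntermediateField.AdjoinSimple.gen ℚ (Real.sqrt (Nat.card k : ℝ))

/-- The completed Hall algebra `Ĥ = ∏_α H_α`. Its elements are the formal sums `∑ a_M [M]` over all
isomorphism classes of representations. (Over a finite field there are only finitely many classes
of a given dimension vector.) -/
def Hall (k : Type w) [Field k] (V : Type u) [Quiver.{v} V] :=
  ∀ α : V → ℕ, IsoClass k α → Coeff k

/-- The quantum torus `A_q`. The underlying vector space is `ℚ(q^{1/2})⟦xᵢ⟧`, and an element is the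
family of the coefficients of the monomials `x^α`. -/
def QTorus (k : Type w) (V : Type u) := (V → ℕ) → Coeff k

instance (k : Type w) [Field k] (V : Type u) [Quiver.{v} V] : AddCommGroup (Hall k V) :=
  inferInstanceAs (AddCommGroup (∀ α : V → ℕ, IsoClass k α → Coeff k))

instance (k : Type w) [Field k] (V : Type u) [Quiver.{v} V] : Module (Coeff k) (Hall k V) :=
  inferInstanceAs (Module (Coeff k) (∀ α : V → ℕ, IsoClass k α → Coeff k))

instance (k : Type w) (V : Type u) : AddCommGroup (QTorus k V) :=
  inferInstanceAs (AddCommGroup ((V → ℕ) → Coeff k))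

instance (k : Type w) (V : Type u) : Module (Coeff k) (QTorus k V) :=
  inferInstanceAs (Module (Coeff k) ((V → ℕ) → Coeff k))

/-- The component of degree `α` of an element of the completed Hall algebra. -/
def Hall.component {k : Type w} [Field k] {V : Type u} [Quiver.{v} V] (α : V → ℕ)
    (f : Hall k V) : IsoClass k α → Coeff k := f α

/-- The coefficient of `x^α`. -/
def QTorus.coeff {k : Type w} {V : Type u} (α : V → ℕ) (f : QTorus k V) : Coeff k := f α

/-- The completed equivariant Hall algebra: all `∑ a_M [M]` with `a_{tM} = a_M` for `t ∈ k^*`. -/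
def HallEq (k : Type w) [Field k] {V : Type u} [Quiver.{v} V] (wt : Arrow V → ℕ) :
    Submodule (Coeff k) (Hall k V) where
  carrier := {f | ∀ (t : kˣ) (α : V → ℕ) (X : IsoClass k α), f α (X.scale wt t) = f α X}
  add_mem' hf hg t α X := congrArg₂ (· + ·) (hf t α X) (hg t α X)
  zero_mem' _ _ _ := rfl
  smul_mem' c _ hf t α X := congrArg (c * ·) (hf t α X)

variable {k : Type w} [Field k] {V : Type u} [Quiver.{v} V] [Fintype V]

open Classical in
/-- The element `Ã_μ^θ`: the sum of all classes of `θ`-semistable representations of slope `μ`.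
The zero representation counts as semistable of every slope. -/
def hallSeries (θ : V → ℝ) (μ : ℝ) : Hall k V := fun α M =>
  if M.Semistable θ ∧ (α = 0 ∨ slope θ α = μ) then 1 else 0

/-- `Ã_μ^θ` is equivariant. -/
lemma hallSeries_mem (wt : Arrow V → ℕ) (θ : V → ℝ) (μ : ℝ) :
    (hallSeries θ μ : Hall k V) ∈ HallEq k wt := by
  intro t α X
  unfold hallSeries
  rw [IsoClass.semistable_scale]

/-- `Ã_μ^θ` as an element of the completed equivariant Hall algebra. -/
def hallSeriesEq (wt : Arrow V → ℕ) (θ : V → ℝ) (μ : ℝ) : HallEq k wt :=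
  ⟨hallSeries θ μ, hallSeries_mem wt θ μ⟩

variable [Finite k] [∀ i j : V, Fintype (i ⟶ j)]

/-- The Hall multiplication `[N] ∘ [M] = ∑_X F_{MN}^X [X]`, extended to formal sums. -/
instance : Mul (Hall k V) where
  mul f g := fun α X => open Classical in
    ∑ β ∈ Finset.Iic α, ∑ N : IsoClass k β, ∑ M : IsoClass k (α - β),
      f β N * g (α - β) M * (hallNumber M N X : Coeff k)

open Classical in
/-- The unit of the Hall algebra, the class of the zero representation. -/
instance : One (Hall k V) where
  one := fun α _ => if α = 0 then 1 else 0

/-- The multiplication `x^α ∘ x^β = (-q^{1/2})^{⟨α, β⟩} x^{α + β}` of the quantum torus. -/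
instance : Mul (QTorus k V) where
  mul f g := fun α => open Classical in
    ∑ β ∈ Finset.Iic α,
      (-sqrtq k) ^ skewForm (toInt β) (toInt (α - β)) * (f β * g (α - β))

open Classical in
/-- The unit `x^0` of the quantum torus. -/
instance : One (QTorus k V) where
  one := fun α => if α = 0 then 1 else 0

/-- The integration map `I : Ĥ → A_q`, `[M] ↦ (-q^{1/2})^{T(dim M)} / #Aut M · x^{dim M}`. -/
def integration : Hall k V →ₗ[Coeff k] QTorus k V where
  toFun f := fun α =>
    ∑ M : IsoClass k α, f α M * ((-sqrtq k) ^ titsForm (toInt α) / (M.cardAut : Coeff k))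
  map_add' f g := by
    funext α
    refine Eq.trans (Finset.sum_congr rfl fun M _ => ?_) Finset.sum_add_distrib
    exact add_mul (f α M) (g α M) _
  map_smul' c f := by
    funext α
    refine Eq.trans (Finset.sum_congr rfl fun M _ => ?_) (Finset.mul_sum _ _ _).symm
    exact mul_assoc c (f α M) _

open Classical in
/-- The map `f = ∑ a_M [M] ↦ f₀ = ∑_{w(M) = 0} a_M [M]`. -/
def zeroPart (W : Potential k V) : Hall k V →ₗ[Coeff k] Hall k V where
  toFun f := fun _ M => if M.w W = 0 then f _ M else 0
  map_add' f g := by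
    funext α M
    change (if M.w W = 0 then f α M + g α M else 0) =
      (if M.w W = 0 then f α M else 0) + (if M.w W = 0 then g α M else 0)
    split_ifs <;> simp
  map_smul' c f := by
    funext α M
    change (if M.w W = 0 then c * f α M else 0) = c * (if M.w W = 0 then f α M else 0)
    split_ifs <;> simp

/-- The equivariant integration map `I_eq(f) = (I(f) - q I(f₀)) / (1 - q)`. -/
def eqIntegration (W : Potential k V) (wt : Arrow V → ℕ) :
    HallEq k wt →ₗ[Coeff k] QTorus k V :=
  ((1 - (Nat.card k : Coeff k))⁻¹ •
    (integration - (Nat.card k : Coeff k) • (integration ∘ₗ zeroPart W))) ∘ₗ (HallEq k wt).subtype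

/-- The Donaldson–Thomas series `A_μ^θ = I_eq(Ã_μ^θ)`. -/
def dtSeries (W : Potential k V) (wt : Arrow V → ℕ) (θ : V → ℝ) (μ : ℝ) : QTorus k V :=
  eqIntegration W wt (hallSeriesEq wt θ μ)

end Algebras

/-! ### Ordered products -/

/-- The product of `f μ` over a finite set of real numbers, in decreasing order of `μ` (the factor
of the largest `μ` is the leftmost one). -/
def decreasingProd {R : Type*} [Mul R] [One R] (f : ℝ → R) (S : Finset ℝ) : R :=
  ((S.sort (· ≥ ·)).map f).prod

/-- `a` is the product of all `f μ`, `μ ∈ ℝ`, in decreasing order of `μ`, in a completed graded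
algebra: for every degree `i`, the products over finite sets `S` of real numbers have the same
component of degree `i` as `a` once `S` is large enough. -/
def HasDecreasingProd {R ι : Type*} {B : ι → Type*} [Mul R] [One R] (component : ∀ i, R → B i)
    (f : ℝ → R) (a : R) : Prop :=
  ∀ i, ∀ᶠ S : Finset ℝ in Filter.atTop, component i (decreasingProd f S) = component i a

end QuiverDT

end

noncomputable section

namespace QuiverDT

/-! ### Values of a Hall algebra element on arbitrary finite-dimensional representations -/

section Eval

variable {V : Type u} [Quiver.{v} V] {k : Type w} [Field k]
variable {E : V → Type w} [∀ i, AddCommGroup (E i)] [∀ i, Module k (E i)]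
variable {E' : V → Type w} [∀ i, AddCommGroup (E' i)] [∀ i, Module k (E' i)]

/-! The Hall algebra identity is the existence and uniqueness of Harder–Narasimhan filtrations. By
`Hall.eval_mul` the coefficient of `M` in an ordered product of the series counts filtrations of `M`
with zero or semistable pieces of the prescribed decreasing slopes. Uniqueness makes this count 0 or
1 (`eval_prod_hallSeries`), and it is 1 as soon as the finite set contains the slopes of all nonzero
dimension vectors below that of `M`.

To pass to the quantum torus, `integration_mul` shows that `I` is multiplicative. Isomorphism
classes weighted by 1/#Aut become points of a representation space divided by the order of ∏ GL, and
pairs (representation, subrepresentation) are counted by block-triangular matrices; the power of q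
that arises is absorbed by the Tits form.

For `I_eq`, the trace w is additive on short exact sequences, so the parts f_c of f (where w = c)
multiply by convolution over k. If t ↦ t^{wt(u)} is one and the same surjection of k^* for all
cycles u of W, equivariance makes I(f_c) independent of c ≠ 0. Then I_eq(f) = I(f_0) - I(f_1), and
this difference is multiplicative under convolution (`sum_mul_sub_sum_mul`, `eqIntegration_mul`).

Coprimality of d and q - 1 gives this surjection for the given weight. Without it, the splitting of
ω supplies another weight for which t^{wt'(u)} = t. The semistable series are equivariant for every
weight, and the formula for I_eq does not involve the weight, so the relation proved with wt' is the
relation for wt. -/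

/-- The transport of a representation along a family of isomorphisms of vector spaces. -/
def transport (g : ∀ i, E i ≃ₗ[k] E' i) (M : QRep k E) : QRep k E' :=
  fun i j a => (g j).toLinearMap ∘ₗ M a ∘ₗ (g i).symm.toLinearMap

/-- A representation is isomorphic to its transport. -/
def transportIso (g : ∀ i, E i ≃ₗ[k] E' i) (M : QRep k E) : RepIso M (transport g M) where
  map := g
  comm i j a x := by simp [transport]

lemma exists_repSpace [∀ i, FiniteDimensional k (E i)] (M : QRep k E) {α : V → ℕ}
    (h : ∀ i, Module.finrank k (E i) = α i) : ∃ X : RepSpace k α, Nonempty (RepIso M X) :=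
  ⟨_, ⟨transportIso (fun i => LinearEquiv.ofFinrankEq (E i) (Fin (α i) → k) (by simp [h])) M⟩⟩

/-- The class of a point of `R(Q, α)`. -/
def IsoClass.mk {α : V → ℕ} (X : RepSpace k α) : IsoClass k α := Quotient.mk (isoSetoid k α) X

lemma IsoClass.mk_eq_mk {α : V → ℕ} {X Y : RepSpace k α} :
    IsoClass.mk X = IsoClass.mk Y ↔ Nonempty (RepIso X Y) :=
  Quotient.eq (r := isoSetoid k α)

lemma IsoClass.mk_rep {α : V → ℕ} (X : IsoClass k α) : IsoClass.mk X.rep = X := Quotient.out_eq X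

/-- The isomorphism class of a representation. -/
def isoClass [∀ i, FiniteDimensional k (E i)] (M : QRep k E) :
    IsoClass k (fun i => Module.finrank k (E i)) :=
  IsoClass.mk (exists_repSpace M fun _ => rfl).choose

/-- The coefficient of the class of `M` in an element of the completed Hall algebra. -/
def Hall.eval [∀ i, FiniteDimensional k (E i)] (f : Hall k V) (M : QRep k E) : Coeff k :=
  f _ (isoClass M)

/-- Keeping `α` a variable lets `g` force its equality with the finranks, which is then substituted;
this absorbs all transport between equal dimension vectors. -/
lemma Hall.eval_eq [∀ i, FiniteDimensional k (E i)] (f : Hall k V) {M : QRep k E} {α : V → ℕ}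
    {X : RepSpace k α} (g : RepIso M X) :
    f.eval M = f α (IsoClass.mk X) := by
  obtain rfl : α = fun i => Module.finrank k (E i) := by
    funext i
    simpa using (g.map i).finrank_eq.symm
  obtain ⟨h⟩ := (exists_repSpace M fun _ => rfl).choose_spec
  exact congrArg (f _) (IsoClass.mk_eq_mk.2 ⟨h.symm.trans g⟩)

lemma Hall.eval_mk (f : Hall k V) {α : V → ℕ} (X : RepSpace k α) :
    f.eval X = f α (IsoClass.mk X) :=
  f.eval_eq (RepIso.refl X)

lemma Hall.eval_rep (f : Hall k V) {α : V → ℕ} (X : IsoClass k α) : f.eval X.rep = f α X := by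
  rw [f.eval_mk, X.mk_rep]

lemma Hall.eval_congr [∀ i, FiniteDimensional k (E i)] [∀ i, FiniteDimensional k (E' i)]
    (f : Hall k V) {M : QRep k E} {N : QRep k E'} (g : RepIso M N) : f.eval M = f.eval N := by
  obtain ⟨X, ⟨h⟩⟩ := exists_repSpace N fun _ => rfl
  rw [f.eval_eq h, f.eval_eq (g.trans h)]

lemma Hall.ext_eval {f g : Hall k V}
    (h : ∀ (α : V → ℕ) (X : RepSpace k α), f.eval X = g.eval X) : f = g := by
  funext α X
  rw [← f.eval_rep, ← g.eval_rep, h]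

lemma nonempty_repIso_rep_iff {M : QRep k E} {α : V → ℕ} {X : RepSpace k α} (g : RepIso M X)
    (N : IsoClass k α) :
    Nonempty (RepIso M N.rep) ↔ N = IsoClass.mk X := by
  nth_rw 2 [← N.mk_rep]
  rw [IsoClass.mk_eq_mk]
  exact ⟨fun ⟨h⟩ => ⟨h.symm.trans g⟩, fun ⟨h⟩ => ⟨g.trans h.symm⟩⟩

@[ext]
lemma SubRep.ext {M : QRep k E} {U U' : SubRep M} (h : ∀ i, U.space i = U'.space i) : U = U' := by
  cases U; cases U'
  congr
  exact funext h

instance [Finite V] [Finite k] [∀ i, FiniteDimensional k (E i)] (M : QRep k E) :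
    Finite (SubRep M) := by
  have (i : V) : Finite (E i) := Module.finite_of_finite k
  exact Finite.of_injective SubRep.space fun U U' h => SubRep.ext fun i => congrFun h i

instance [Finite V] [Finite k] [∀ i, FiniteDimensional k (E i)] (M : QRep k E) :
    Fintype (SubRep M) := Fintype.ofFinite _

/-- An isomorphism induces a bijection between subrepresentations. -/
def SubRep.imageEquiv {M : QRep k E} {N : QRep k E'} (g : RepIso M N) : SubRep M ≃ SubRep N where
  toFun U := U.image g
  invFun U := U.image g.symm
  left_inv U := by
    ext i x
    simp [SubRep.image, RepIso.symm]
  right_inv U := by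
    ext i x
    simp [SubRep.image, RepIso.symm]

/-- A subrepresentation is isomorphic to its image. -/
def SubRep.repImageIso {M : QRep k E} {N : QRep k E'} (g : RepIso M N) (U : SubRep M) :
    RepIso U.rep (U.image g).rep where
  map i := (g.map i).submoduleMap (U.space i)
  comm _ _ a x := Subtype.ext (g.comm a x)

/-- The quotients by a subrepresentation and by its image are isomorphic. -/
def SubRep.quotImageIso {M : QRep k E} {N : QRep k E'} (g : RepIso M N) (U : SubRep M) :
    RepIso U.quot (U.image g).quot where
  map i := Submodule.Quotient.equiv _ _ (g.map i) rfl
  comm _ j a x := by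
    obtain ⟨y, rfl⟩ := Submodule.mkQ_surjective _ x
    exact congrArg ((U.image g).space j).mkQ (g.comm a y)

lemma finrank_sub_quot [∀ i, FiniteDimensional k (E i)] {M : QRep k E} (U : SubRep M) (i : V) :
    Module.finrank k (E i ⧸ U.space i) + Module.finrank k (U.space i) =
      Module.finrank k (E i) :=
  Submodule.finrank_quotient_add_finrank _

open Classical in
lemma Hall.eval_one [Fintype V] [∀ i, FiniteDimensional k (E i)] (M : QRep k E) :
    (1 : Hall k V).eval M = if ∀ i, Module.finrank k (E i) = 0 then 1 else 0 := by
  change (if (fun i => Module.finrank k (E i)) = 0 then (1 : Coeff k) else 0) = _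
  simp only [funext_iff, Pi.zero_apply]

variable [Fintype V] [∀ i j : V, Fintype (i ⟶ j)] [Finite k]

-- A fixed `U` contributes to exactly one triple (β, N, L), namely its dimension vector and the
-- classes of `U` and of the quotient. Exchanging sums then turns Hall numbers into a sum over
-- subrepresentations.
open Classical in
lemma Hall.sum_mul_sub (f g : Hall k V) {α : V → ℕ} {M : RepSpace k α} (U : SubRep M) :
    ∑ β ∈ Finset.Iic α, ∑ N : IsoClass k β, ∑ L : IsoClass k (α - β), f β N * g (α - β) L *
      (if Nonempty (RepIso U.rep N.rep) ∧ Nonempty (RepIso U.quot L.rep) then 1 else 0) =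
    f.eval U.rep * g.eval U.quot := by
  have hd (i : V) := finrank_sub_quot U i
  simp only [Module.finrank_fin_fun] at hd
  rw [Finset.sum_eq_single (fun i => Module.finrank k (U.space i))]
  · obtain ⟨N', ⟨n⟩⟩ := exists_repSpace U.rep fun _ => rfl
    obtain ⟨L', ⟨l⟩⟩ := exists_repSpace U.quot
      (α := α - fun i => Module.finrank k (U.space i)) fun i => by
        simp only [Pi.sub_apply, ← hd i, Nat.add_sub_cancel]
    rw [f.eval_eq n, g.eval_eq l]
    simp only [nonempty_repIso_rep_iff n, nonempty_repIso_rep_iff l]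
    rw [Fintype.sum_eq_single (IsoClass.mk N'),
      Fintype.sum_eq_single (IsoClass.mk L')]
    · simp
    · intro L hL
      simp [hL]
    · intro N hN
      simp [hN]
  · intro β _ hβ
    refine Finset.sum_eq_zero fun N _ => Finset.sum_eq_zero fun L _ => ?_
    rw [if_neg, mul_zero]
    rintro ⟨⟨n⟩, -⟩
    exact hβ (funext fun i => by simpa using (n.map i).finrank_eq.symm)
  · intro h
    refine (h (Finset.mem_Iic.2 fun i => ?_)).elim
    have := hd i
    dsimp only
    lia

/-- The Hall product, as a sum over subrepresentations. -/
lemma Hall.eval_mul [∀ i, FiniteDimensional k (E i)] (f g : Hall k V) (M : QRep k E) :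
    (f * g).eval M = ∑ U : SubRep M, f.eval U.rep * g.eval U.quot := by
  classical
  obtain ⟨α, X, ⟨h⟩⟩ : ∃ α, ∃ X : RepSpace k α, Nonempty (RepIso M X) :=
    ⟨_, exists_repSpace M fun _ => rfl⟩
  -- Hall numbers refer to the chosen representative of a class, so `M` is compared with that
  -- representative.
  obtain ⟨h'⟩ := (nonempty_repIso_rep_iff h (IsoClass.mk X)).2 rfl
  rw [(f * g).eval_eq h, ← Equiv.sum_comp (SubRep.imageEquiv h'.symm)]
  trans ∑ U : SubRep (IsoClass.mk X).rep, f.eval U.rep * g.eval U.quot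
  · simp_rw [← Hall.sum_mul_sub]
    change ∑ β ∈ Finset.Iic _, ∑ N : IsoClass k β, ∑ L : IsoClass k (_ - β),
        f β N * g (_ - β) L * (hallNumber L N _ : Coeff k) = _
    symm
    rw [Finset.sum_comm]
    refine Finset.sum_congr rfl fun β _ => ?_
    rw [Finset.sum_comm]
    refine Finset.sum_congr rfl fun N _ => ?_
    rw [Finset.sum_comm]
    refine Finset.sum_congr rfl fun L _ => ?_
    rw [← Finset.mul_sum, Finset.sum_boole]
    refine congrArg (fun n : ℕ => f β N * g (α - β) L * (n : Coeff k)) ?_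
    rw [hallNumber, Nat.card_eq_fintype_card, Fintype.card_subtype]
  · congr 1; funext U
    exact congrArg₂ (· * ·) (f.eval_congr (U.repImageIso h'.symm))
      (g.eval_congr (U.quotImageIso h'.symm))

end Eval

/-! ### Harder–Narasimhan filtrations -/

section HarderNarasimhan

section LinearAlgebra

variable {k : Type*} [Field k] {E : Type*} [AddCommGroup E] [Module k E]

lemma finrank_comap_subtype (U N : Submodule k E) :
    Module.finrank k (N.comap U.subtype) = Module.finrank k (U ⊓ N : Submodule k E) := by
  rw [← Submodule.map_comap_subtype, Submodule.finrank_map_subtype_eq]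

lemma finrank_map_mkQ_add [FiniteDimensional k E] (U N : Submodule k E) :
    Module.finrank k (N.map U.mkQ) + Module.finrank k (U ⊓ N : Submodule k E) =
      Module.finrank k N := by
  have h := LinearMap.finrank_range_add_finrank_ker (U.mkQ.domRestrict N)
  rw [LinearMap.range_domRestrict, LinearMap.ker_domRestrict, Submodule.ker_mkQ,
    finrank_comap_subtype, inf_comm] at h
  exact h

end LinearAlgebra

variable {V : Type u} [Quiver.{v} V] {k : Type w} [Field k]
variable {E : V → Type w} [∀ i, AddCommGroup (E i)] [∀ i, Module k (E i)]

variable (k) in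
/-- The dimension vector of a family of vector spaces. -/
def dimVec (E : V → Type w) [∀ i, AddCommGroup (E i)] [∀ i, Module k (E i)] : V → ℕ :=
  fun i => Module.finrank k (E i)

/-- The dimension vector of a subrepresentation. -/
def SubRep.dim {M : QRep k E} (U : SubRep M) : V → ℕ := fun i => Module.finrank k (U.space i)

/-- The zero subrepresentation. -/
def SubRep.zero (M : QRep k E) : SubRep M where
  space _ := ⊥
  map_mem _ _ a _ hx := by simp_all

/-- The whole representation as a subrepresentation. -/
def SubRep.whole (M : QRep k E) : SubRep M where
  space _ := ⊤
  map_mem _ _ _ _ _ := trivial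

/-- The intersection of `N` and `U`, as a subrepresentation of `U`. -/
def SubRep.restrictTo {M : QRep k E} (N U : SubRep M) : SubRep U.rep where
  space i := (N.space i).comap (U.space i).subtype
  map_mem _ _ a x hx := N.map_mem a x hx

/-- The image of `N` in `M / U`. -/
def SubRep.imageQuot {M : QRep k E} (N U : SubRep M) : SubRep U.quot where
  space i := (N.space i).map (U.space i).mkQ
  map_mem _ _ a _ hx := by
    obtain ⟨y, hy, rfl⟩ := hx
    exact ⟨M a y, N.map_mem a y hy, rfl⟩

/-- The preimage in `M` of a subrepresentation of `M / U`. -/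
def SubRep.preimageQuot {M : QRep k E} (U : SubRep M) (N : SubRep U.quot) : SubRep M where
  space i := (N.space i).comap (U.space i).mkQ
  map_mem _ _ a _ hx := N.map_mem a _ hx

lemma SubRep.dim_restrictTo_comm {M : QRep k E} (N U : SubRep M) :
    (N.restrictTo U).dim = (U.restrictTo N).dim := by
  funext i
  change Module.finrank k ((N.space i).comap (U.space i).subtype) =
    Module.finrank k ((U.space i).comap (N.space i).subtype)
  rw [finrank_comap_subtype, finrank_comap_subtype, inf_comm]

section Dim

variable [∀ i, FiniteDimensional k (E i)] {M : QRep k E}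

lemma SubRep.dim_imageQuot_add (N U : SubRep M) :
    N.dim =
      (N.imageQuot U).dim + (N.restrictTo U).dim := by
  funext i
  have := finrank_map_mkQ_add (U.space i) (N.space i)
  rw [← finrank_comap_subtype] at this
  exact this.symm

lemma SubRep.dim_preimageQuot (U : SubRep M) (N : SubRep U.quot) :
    (U.preimageQuot N).dim =
      N.dim + U.dim := by
  funext i
  have := finrank_map_mkQ_add (U.space i) ((N.space i).comap (U.space i).mkQ)
  rw [Submodule.map_comap_eq_of_surjective (Submodule.mkQ_surjective _),
    inf_eq_left.2 (Submodule.le_comap_mkQ _ _)] at this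
  exact this.symm

lemma SubRep.dim_le (U : SubRep M) : U.dim ≤ dimVec k E :=
  fun i => Submodule.finrank_le (U.space i)

lemma SubRep.dim_eq_zero_iff (U : SubRep M) :
    U.dim = 0 ↔ ∀ i, U.space i = ⊥ := by
  simp [funext_iff, SubRep.dim]

lemma SubRep.dim_eq_iff (U : SubRep M) :
    U.dim = dimVec k E ↔ ∀ i, U.space i = ⊤ := by
  simp only [funext_iff, SubRep.dim, dimVec]
  exact forall_congr' fun i =>
    ⟨Submodule.eq_top_of_finrank_eq, fun h =>
      (congrArg (fun p : Submodule k (E i) => Module.finrank k p) h).trans (finrank_top k (E i))⟩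

lemma SubRep.dimVec_quot_le (U : SubRep M) : dimVec k (fun i => E i ⧸ U.space i) ≤ dimVec k E :=
  fun i => Submodule.finrank_quotient_le (U.space i)

end Dim

lemma SubRep.dim_zero (M : QRep k E) : (SubRep.zero M).dim = 0 := by
  funext i
  exact finrank_bot k (E i)

lemma SubRep.dim_whole (M : QRep k E) :
    (SubRep.whole M).dim = dimVec k E := by
  funext i
  exact finrank_top k (E i)

variable [Fintype V]

/-- The degree `∑ᵢ (θᵢ - c) αᵢ`, whose sign compares the slope of `α` with `c`. -/
def shiftedDegree (θ : V → ℝ) (c : ℝ) (α : V → ℕ) : ℝ := ∑ i, (θ i - c) * (α i : ℝ)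

section Degree

variable {W : Type u} [Fintype W] (θ : W → ℝ)

lemma shiftedDegree_add (c : ℝ) (α β : W → ℕ) :
    shiftedDegree θ c (α + β) = shiftedDegree θ c α + shiftedDegree θ c β := by
  simp [shiftedDegree, mul_add, Finset.sum_add_distrib]

lemma shiftedDegree_zero (c : ℝ) : shiftedDegree θ c 0 = 0 := by
  simp [shiftedDegree]

lemma shiftedDegree_change (c d : ℝ) (α : W → ℕ) :
    shiftedDegree θ c α = shiftedDegree θ d α + (d - c) * ∑ i, (α i : ℝ) := by
  simp only [shiftedDegree, Finset.mul_sum, ← Finset.sum_add_distrib]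
  exact Finset.sum_congr rfl fun i _ => by ring

lemma sum_pos_of_ne_zero {α : W → ℕ} (h : α ≠ 0) : 0 < ∑ i, (α i : ℝ) := by
  obtain ⟨i, hi⟩ := Function.ne_iff.1 h
  exact Finset.sum_pos' (fun _ _ => Nat.cast_nonneg _)
    ⟨i, Finset.mem_univ _, Nat.cast_pos.2 (Nat.pos_of_ne_zero hi)⟩

lemma shiftedDegree_eq {α : W → ℕ} (h : α ≠ 0) (c : ℝ) :
    shiftedDegree θ c α = (slope θ α - c) * ∑ i, (α i : ℝ) := by
  rw [slope, sub_mul, div_mul_cancel₀ _ (sum_pos_of_ne_zero h).ne', shiftedDegree]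
  simp [sub_mul, Finset.sum_sub_distrib, Finset.mul_sum]

lemma shiftedDegree_nonpos_iff {α : W → ℕ} (h : α ≠ 0) (c : ℝ) :
    shiftedDegree θ c α ≤ 0 ↔ slope θ α ≤ c := by
  rw [shiftedDegree_eq θ h, ← not_lt, mul_pos_iff_of_pos_right (sum_pos_of_ne_zero h), not_lt,
    sub_nonpos]

lemma shiftedDegree_eq_zero_iff {α : W → ℕ} (h : α ≠ 0) (c : ℝ) :
    shiftedDegree θ c α = 0 ↔ slope θ α = c := by
  rw [shiftedDegree_eq θ h, mul_eq_zero, or_iff_left (sum_pos_of_ne_zero h).ne', sub_eq_zero]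

end Degree

/-- `M` is zero, or semistable of slope `μ`. -/
def SemistableOfSlope (θ : V → ℝ) (μ : ℝ) (M : QRep k E) : Prop :=
  shiftedDegree θ μ (dimVec k E) = 0 ∧
    ∀ U : SubRep M, shiftedDegree θ μ U.dim ≤ 0

/-- The zero subrepresentation and, at slope `μ`, the whole one have shifted degree 0, so dropping
the properness conditions on `U` changes nothing. -/
lemma semistableOfSlope_iff [∀ i, FiniteDimensional k (E i)] (θ : V → ℝ) (μ : ℝ) (M : QRep k E) :
    SemistableOfSlope θ μ M ↔
      IsSemistable θ M ∧ (dimVec k E = 0 ∨ slope θ (dimVec k E) = μ) := by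
  by_cases h0 : dimVec k E = 0
  · have hz (U : SubRep M) : U.dim = 0 :=
      le_antisymm (h0 ▸ U.dim_le) (zero_le)
    simp only [SemistableOfSlope, h0, hz, shiftedDegree_zero, le_refl, implies_true, true_or,
      and_true, true_iff]
    rintro U ⟨i, hi⟩
    exact absurd ((SubRep.dim_eq_zero_iff U).1 (hz U) i) hi
  · rw [or_iff_right h0, SemistableOfSlope, shiftedDegree_eq_zero_iff θ h0, and_comm]
    refine and_congr_left fun hμ => ⟨fun h U hU _ => ?_, fun h U => ?_⟩
    · have hU' : U.dim ≠ 0 := by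
        rw [Ne, SubRep.dim_eq_zero_iff]
        push Not
        exact hU
      exact ((shiftedDegree_nonpos_iff θ hU' μ).1 (h U)).trans hμ.ge
    · by_cases hU : U.dim = 0
      · rw [hU, shiftedDegree_zero]
      by_cases hU' : U.dim = dimVec k E
      · rw [hU', (shiftedDegree_eq_zero_iff θ h0 μ).2 hμ]
      rw [shiftedDegree_nonpos_iff θ hU, ← hμ]
      rw [SubRep.dim_eq_zero_iff] at hU
      rw [SubRep.dim_eq_iff] at hU'
      push Not at hU hU'
      exact h U hU hU'

open Classical in
lemma eval_hallSeries [∀ i, FiniteDimensional k (E i)] (θ : V → ℝ) (μ : ℝ) (M : QRep k E) :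
    (hallSeries θ μ : Hall k V).eval M = if SemistableOfSlope θ μ M then 1 else 0 := by
  have h : (isoClass M).Semistable θ ↔ IsSemistable θ M := by
    obtain ⟨g⟩ := (exists_repSpace M fun _ => rfl).choose_spec
    exact ⟨fun h => h.congr g, fun h => h.congr g.symm⟩
  exact if_congr ((and_congr_left' h).trans (semistableOfSlope_iff θ μ M).symm) rfl rfl

/-- `M` has a filtration whose successive quotients are zero or semistable, of the slopes in the
given list. -/
def HasHNFiltration (θ : V → ℝ) : List ℝ → ∀ {E : V → Type w} [∀ i, AddCommGroup (E i)]
    [∀ i, Module k (E i)], QRep k E → Prop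
  | [], E, _, _, _ => dimVec k E = 0
  | μ :: L, _, _, _, M =>
    ∃ U : SubRep M, SemistableOfSlope θ μ U.rep ∧ HasHNFiltration θ L U.quot

/-- This replaces the vanishing of Hom from larger to smaller slope. `N` is cut into its
intersection with `U` and its image in the quotient; a nonzero piece of degree at most 0 at its own
slope `ν < μ` has negative degree at `μ`. -/
lemma HasHNFiltration.shiftedDegree_neg (θ : V → ℝ) {μ : ℝ} {L : List ℝ} (hL : ∀ ν ∈ L, ν < μ)
    {E : V → Type w} [∀ i, AddCommGroup (E i)] [∀ i, Module k (E i)]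
    [∀ i, FiniteDimensional k (E i)] {M : QRep k E} (h : HasHNFiltration θ L M) (N : SubRep M)
    (hN : N.dim ≠ 0) :
    shiftedDegree θ μ N.dim < 0 := by
  induction L generalizing E with
  | nil => exact absurd (le_antisymm (N.dim_le.trans_eq h) zero_le) hN
  | cons ν L ih =>
    obtain ⟨U, hU, hq⟩ := h
    have hν : ν < μ := hL ν (by simp)
    have h2 := hU.2 (N.restrictTo U)
    have hdim := N.dim_imageQuot_add U
    have hc := shiftedDegree_change θ μ ν (N.restrictTo U).dim
    by_cases h0 : (N.imageQuot U).dim = 0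
    · rw [h0, zero_add] at hdim
      rw [hdim] at hN ⊢
      have := mul_neg_of_neg_of_pos (sub_neg.2 hν) (sum_pos_of_ne_zero hN)
      linarith
    · have h1 := ih (fun ν' h' => hL ν' (by simp [h'])) hq (N.imageQuot U) h0
      rw [hdim, shiftedDegree_add]
      have := mul_nonpos_of_nonpos_of_nonneg (sub_neg.2 hν).le
        (Finset.sum_nonneg fun i (_ : i ∈ Finset.univ) =>
          Nat.cast_nonneg (α := ℝ) ((N.restrictTo U).dim i))
      linarith

/-- At `μ`, `U'` has degree 0 and its intersection with `U` has degree at most 0, so the image of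
`U'` in the quotient by `U` has degree at least 0. By `shiftedDegree_neg` that image is zero, hence
`U' ≤ U`; the roles are symmetric. -/
lemma HasHNFiltration.unique [∀ i, FiniteDimensional k (E i)] (θ : V → ℝ) {μ : ℝ} {L : List ℝ}
    (hL : ∀ ν ∈ L, ν < μ) {M : QRep k E} {U U' : SubRep M} (hU : HasHNFiltration θ L U.quot)
    (hU' : HasHNFiltration θ L U'.quot) (h : SemistableOfSlope θ μ U.rep)
    (h' : SemistableOfSlope θ μ U'.rep) : U = U' := by
  have key {U U' : SubRep M} (hU : HasHNFiltration θ L U.quot)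
      (h' : SemistableOfSlope θ μ U'.rep) (i : V) : U'.space i ≤ U.space i := by
    have h1 : shiftedDegree θ μ U'.dim = 0 := h'.1
    have h2 := h'.2 (U.restrictTo U')
    rw [U'.dim_imageQuot_add U, shiftedDegree_add, U'.dim_restrictTo_comm U] at h1
    have h0 : (U'.imageQuot U).dim = 0 := by
      by_contra hne
      have := hU.shiftedDegree_neg θ hL _ hne
      linarith
    rw [SubRep.dim_eq_zero_iff] at h0
    have := LinearMap.le_ker_iff_map.2 (h0 i)
    rwa [Submodule.ker_mkQ] at this
  exact SubRep.ext fun i => le_antisymm (key hU' h i) (key hU h' i)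

/-- Only slopes not exceeding the slope of some nonzero subrepresentation are required to lie in
`L`. This restriction is what survives induction: after splitting off the part of slope `μ`, the
relevant slopes of the quotient are below `μ` and must lie in the tail. -/
lemma exists_hasHNFiltration [Finite k] (θ : V → ℝ) {L : List ℝ} (hL : L.Pairwise (· > ·))
    {E : V → Type w} [∀ i, AddCommGroup (E i)] [∀ i, Module k (E i)]
    [∀ i, FiniteDimensional k (E i)] (M : QRep k E)
    (h : ∀ β : V → ℕ, β ≠ 0 → β ≤ dimVec k E →
      (∃ N : SubRep M, N.dim ≠ 0 ∧
        0 ≤ shiftedDegree θ (slope θ β) N.dim) → slope θ β ∈ L) :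
    HasHNFiltration θ L M := by
  induction L generalizing E with
  | nil =>
    by_contra h0
    change dimVec k E ≠ 0 at h0
    refine List.not_mem_nil (h _ h0 le_rfl ⟨SubRep.whole M, ?_, ?_⟩)
    · rwa [SubRep.dim_whole]
    · rw [SubRep.dim_whole, (shiftedDegree_eq_zero_iff θ h0 _).2 rfl]
  | cons μ L ih =>
    rw [List.pairwise_cons] at hL
    have hle (N : SubRep M) : shiftedDegree θ μ N.dim ≤ 0 := by
      by_cases hN : N.dim = 0
      · rw [hN, shiftedDegree_zero]
      rw [shiftedDegree_nonpos_iff θ hN]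
      have := h _ hN N.dim_le ⟨N, hN, ((shiftedDegree_eq_zero_iff θ hN _).2 rfl).ge⟩
      rcases List.mem_cons.1 this with h1 | h1
      · exact h1.le
      · exact (hL.1 _ h1).le
    -- `U` is the largest subrepresentation of slope `μ`. It is zero if `μ` is not attained, which
    -- is why zero pieces are allowed in the filtration.
    obtain ⟨U, hU, hmax⟩ := Set.exists_max_image
      {U : SubRep M | shiftedDegree θ μ U.dim = 0}
      (fun U => ∑ i, (U.dim i : ℝ)) (Set.toFinite _)
      ⟨SubRep.zero M, by rw [Set.mem_ofPred_eq, SubRep.dim_zero, shiftedDegree_zero]⟩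
    have hpre (c : ℝ) (N : SubRep U.quot) :
        shiftedDegree θ c (U.preimageQuot N).dim =
          shiftedDegree θ c N.dim +
          shiftedDegree θ c U.dim := by
      rw [U.dim_preimageQuot N, shiftedDegree_add]
    have hneg (N : SubRep U.quot) (hN : N.dim ≠ 0) :
        shiftedDegree θ μ N.dim < 0 := by
      have h1 := hle (U.preimageQuot N)
      rw [hpre, hU, add_zero] at h1
      refine h1.lt_of_ne fun h2 => ?_
      -- A nonzero `N` of degree 0 would have a preimage of degree 0 strictly larger than `U`.
      have h3 := hmax (U.preimageQuot N) (by rw [Set.mem_ofPred_eq, hpre, hU, h2, add_zero])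
      simp only [U.dim_preimageQuot N, Pi.add_apply, Nat.cast_add, Finset.sum_add_distrib] at h3
      linarith [sum_pos_of_ne_zero hN]
    refine ⟨U, ⟨hU, fun N => ?_⟩, ih hL.2 U.quot fun β hβ hβ' hN => ?_⟩
    · have h1 := hle ⟨fun i => (N.space i).map (U.space i).subtype, fun i j a x hx => by
        obtain ⟨y, hy, rfl⟩ := hx
        exact ⟨U.rep a y, N.map_mem a y hy, rfl⟩⟩
      refine (congrArg (shiftedDegree θ μ) ?_).trans_le h1
      funext i
      exact (Submodule.finrank_map_subtype_eq _ _).symm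
    · obtain ⟨N, hN, hN'⟩ := hN
      have h1 := hneg N hN
      have h2 := shiftedDegree_change θ (slope θ β) μ N.dim
      have h3 := shiftedDegree_change θ (slope θ β) μ U.dim
      rw [hU, zero_add] at h3
      have hlt : slope θ β < μ := by
        by_contra hge
        push Not at hge
        have := mul_nonpos_of_nonpos_of_nonneg (sub_nonpos.2 hge) (sum_pos_of_ne_zero hN).le
        linarith
      -- Lowering the threshold from `μ` keeps the degree of `U` nonnegative, so the preimage of `N`
      -- is a witness in `M` for the slope of `β`.
      have h4 : 0 ≤ shiftedDegree θ (slope θ β) U.dim := by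
        rw [h3]
        exact mul_nonneg (sub_pos.2 hlt).le (Finset.sum_nonneg fun i _ => Nat.cast_nonneg _)
      refine (List.mem_cons.1 (h β hβ (hβ'.trans U.dimVec_quot_le)
        ⟨(U.preimageQuot N), ?_, ?_⟩)).resolve_left hlt.ne
      · rw [U.dim_preimageQuot N]
        intro h0
        exact hN (add_eq_zero.1 h0).1
      · rw [hpre]
        exact add_nonneg hN' h4

-- Peeling off the leftmost factor sums over the first step `U` of a filtration; by
-- `HasHNFiltration.unique` at most one term is nonzero.
open Classical in
lemma eval_prod_hallSeries [∀ i j : V, Fintype (i ⟶ j)] [Finite k] (θ : V → ℝ) {L : List ℝ}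
    (hL : L.Pairwise (· > ·)) {E : V → Type w} [∀ i, AddCommGroup (E i)] [∀ i, Module k (E i)]
    [∀ i, FiniteDimensional k (E i)] (M : QRep k E) :
    ((L.map fun μ => (hallSeries θ μ : Hall k V)).prod).eval M =
      if HasHNFiltration θ L M then 1 else 0 := by
  induction L generalizing E with
  | nil =>
    simp only [List.map_nil, List.prod_nil, Hall.eval_one, HasHNFiltration, dimVec, funext_iff,
      Pi.zero_apply]
  | cons μ L ih =>
    rw [List.pairwise_cons] at hL
    rw [List.map_cons, List.prod_cons, Hall.eval_mul]
    simp only [ih hL.2, eval_hallSeries, ← ite_and, ite_mul, one_mul, zero_mul]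
    by_cases h : ∃ U : SubRep M, SemistableOfSlope θ μ U.rep ∧ HasHNFiltration θ L U.quot
    · obtain ⟨U, hU⟩ := h
      rw [Fintype.sum_eq_single U, if_pos hU, if_pos (show HasHNFiltration θ (μ :: L) M from ⟨U, hU⟩)]
      intro U' hne
      rw [if_neg]
      exact fun hU' => hne (HasHNFiltration.unique θ hL.1 hU'.2 hU.2 hU'.1 hU.1)
    · rw [if_neg (show ¬HasHNFiltration θ (μ :: L) M from h)]
      push Not at h
      exact Finset.sum_eq_zero fun U _ => if_neg fun hU => h U hU.1 hU.2

lemma hallSeries_zero_apply (α : V → ℕ) (X : IsoClass k α) :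
    (hallSeries 0 0 : Hall k V) α X = 1 := by
  induction X using Quotient.inductionOn with
  | h M =>
    refine if_pos ⟨fun U _ _ => ?_, Or.inr ?_⟩ <;> simp [slope]

theorem hasDecreasingProd_hallSeries [∀ i j : V, Fintype (i ⟶ j)] [Finite k] (θ : V → ℝ) :
    HasDecreasingProd Hall.component (fun μ => (hallSeries θ μ : Hall k V)) (hallSeries 0 0) := by
  classical
  intro α
  -- There are finitely many `β ≤ α`; once `S` contains all their slopes, the existence hypothesis
  -- holds for every representation of dimension `α`.
  refine (Filter.eventually_ge_atTop ((Finset.Iic α).image (slope θ))).mono fun S hS => ?_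
  funext X
  change decreasingProd (fun μ => (hallSeries θ μ : Hall k V)) S α X = hallSeries 0 0 α X
  rw [hallSeries_zero_apply, ← Hall.eval_rep (decreasingProd _ S), decreasingProd]
  have hsort : (S.sort (· ≥ ·)).Pairwise (· > ·) :=
    ((S.pairwise_sort (· ≥ ·)).and (S.sort_nodup (· ≥ ·))).imp fun h => lt_of_le_of_ne h.1 h.2.symm
  rw [eval_prod_hallSeries θ hsort, if_pos]
  refine exists_hasHNFiltration θ hsort _ fun β _ hβ _ => ?_
  rw [Finset.mem_sort]
  refine hS (Finset.mem_image_of_mem _ (Finset.mem_Iic.2 (hβ.trans_eq ?_)))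
  funext i
  simp [dimVec]

end HarderNarasimhan

/-! ### Counting linear isomorphisms adapted to a subspace -/

section Linear

variable {k : Type*} [Field k] {E A C : Type*} [AddCommGroup E] [Module k E]
  [AddCommGroup A] [Module k A] [AddCommGroup C] [Module k C]

instance [Finite E] [Finite A] : Finite (E →ₗ[k] A) := DFunLike.finite _

instance [Finite E] [Finite A] : Finite (E ≃ₗ[k] A) := DFunLike.finite _

/-- The subspace of `E` which an isomorphism `E ≅ C × A` maps to `A`. -/
def kerFst (g : E ≃ₗ[k] C × A) : Submodule k E := LinearMap.ker (LinearMap.fst k C A ∘ₗ g.toLinearMap)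

lemma mem_kerFst {g : E ≃ₗ[k] C × A} {x : E} : x ∈ kerFst g ↔ (g x).1 = 0 := Iff.rfl

/-- The isomorphism of `kerFst g` with `A`. -/
def kerFstEquiv (g : E ≃ₗ[k] C × A) : kerFst g ≃ₗ[k] A :=
  LinearEquiv.ofBijective (LinearMap.snd k C A ∘ₗ g.toLinearMap ∘ₗ (kerFst g).subtype) <| by
    constructor
    · rw [injective_iff_map_eq_zero]
      intro x hx
      exact Subtype.ext (g.map_eq_zero_iff.1 (Prod.ext (mem_kerFst.1 x.2) hx))
    · intro a
      exact ⟨⟨g.symm (0, a), by simp [mem_kerFst]⟩, by simp⟩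

/-- The isomorphism of `E / kerFst g` with `C`. -/
def quotKerFstEquiv (g : E ≃ₗ[k] C × A) : (E ⧸ kerFst g) ≃ₗ[k] C :=
  LinearMap.quotKerEquivOfSurjective (LinearMap.fst k C A ∘ₗ g.toLinearMap)
    (Prod.fst_surjective.comp g.surjective)

lemma isEmpty_kerFst_eq (U : Submodule k E) (hU : Module.finrank k U ≠ Module.finrank k A) :
    IsEmpty {g : E ≃ₗ[k] C × A // kerFst g = U} := by
  refine ⟨fun ⟨g, hg⟩ => hU ?_⟩
  rw [← hg]
  exact (kerFstEquiv g).finrank_eq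

variable [FiniteDimensional k E] [FiniteDimensional k A] [FiniteDimensional k C]

lemma exists_kerFst_eq (U : Submodule k E) (hU : Module.finrank k U = Module.finrank k A)
    (hE : Module.finrank k E = Module.finrank k A + Module.finrank k C) :
    ∃ g : E ≃ₗ[k] C × A, kerFst g = U := by
  obtain ⟨U', h⟩ := U.exists_isCompl
  have hU' : Module.finrank k U' = Module.finrank k C := by
    have := Submodule.finrank_add_eq_of_isCompl h
    lia
  refine ⟨(Submodule.prodEquivOfIsCompl U' U h.symm).symm.trans
    ((LinearEquiv.ofFinrankEq U' C hU').prodCongr (LinearEquiv.ofFinrankEq U A hU)), ?_⟩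
  ext x
  simp [mem_kerFst]

/-- By `hp` the map preserves 0 × A and is injective modulo it. It is therefore block triangular
with injective diagonal blocks, which are invertible in finite dimension. -/
lemma exists_skewProd (p : (C × A) ≃ₗ[k] (C × A)) (hp : ∀ x, (p x).1 = 0 ↔ x.1 = 0) :
    ∃ (y : C ≃ₗ[k] C) (x : A ≃ₗ[k] A) (h : C →ₗ[k] A), p = y.skewProd x h := by
  have hy : Function.Injective (LinearMap.fst k C A ∘ₗ p.toLinearMap ∘ₗ LinearMap.inl k C A) := by
    rw [injective_iff_map_eq_zero]
    exact fun c hc => (hp (c, 0)).1 hc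
  have h0 (a : A) : (p (0, a)).1 = 0 := (hp (0, a)).2 rfl
  have hx : Function.Injective (LinearMap.snd k C A ∘ₗ p.toLinearMap ∘ₗ LinearMap.inr k C A) := by
    rw [injective_iff_map_eq_zero]
    intro a ha
    have : p (0, a) = 0 := Prod.ext (h0 a) ha
    exact congrArg Prod.snd (p.map_eq_zero_iff.1 this)
  refine ⟨LinearEquiv.ofInjectiveEndo _ hy, LinearEquiv.ofInjectiveEndo _ hx,
    LinearMap.snd k C A ∘ₗ p.toLinearMap ∘ₗ LinearMap.inl k C A, LinearEquiv.ext fun z => ?_⟩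
  have hz : p z = p (z.1, 0) + p (0, z.2) := by
    rw [← map_add]
    simp
  refine Prod.ext ?_ ?_
  · simp [hz, h0]
  · simp [hz, add_comm]

/-- The isomorphisms adapted to `U` form a torsor under the parabolic group preserving 0 × A, with
Levi factor GL(C) × GL(A) and unipotent radical Hom(C, A). -/
lemma card_kerFst_eq (U : Submodule k E) (hU : Module.finrank k U = Module.finrank k A)
    (hE : Module.finrank k E = Module.finrank k A + Module.finrank k C) :
    Nat.card {g : E ≃ₗ[k] C × A // kerFst g = U} =
      Nat.card (C ≃ₗ[k] C) * (Nat.card (A ≃ₗ[k] A) * Nat.card (C →ₗ[k] A)) := by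
  obtain ⟨g₀, hg₀⟩ := exists_kerFst_eq U hU hE
  rw [← Nat.card_prod, ← Nat.card_prod]
  refine (Nat.card_congr (Equiv.ofBijective
    (fun t : (C ≃ₗ[k] C) × (A ≃ₗ[k] A) × (C →ₗ[k] A) =>
      (⟨g₀.trans (t.1.skewProd t.2.1 t.2.2), ?_⟩ : {g : E ≃ₗ[k] C × A // kerFst g = U}))
    ⟨?_, ?_⟩)).symm
  · rw [← hg₀]
    ext x
    simp [mem_kerFst]
  · rintro ⟨y, x, h⟩ ⟨y', x', h'⟩ heq
    have key (z : C × A) : y.skewProd x h z = y'.skewProd x' h' z := by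
      simpa using LinearEquiv.congr_fun (congrArg Subtype.val heq) (g₀.symm z)
    refine Prod.ext (LinearEquiv.ext fun c => ?_)
      (Prod.ext (LinearEquiv.ext fun a => ?_) (LinearMap.ext fun c => ?_))
    · simpa using congrArg Prod.fst (key (c, 0))
    · simpa using congrArg Prod.snd (key (0, a))
    · simpa using congrArg Prod.snd (key (c, 0))
  · rintro ⟨g, hg⟩
    obtain ⟨y, x, h, hp⟩ := exists_skewProd (g₀.symm.trans g) fun z => by
      have : g₀.symm z ∈ kerFst g ↔ g₀.symm z ∈ kerFst g₀ := by rw [hg, hg₀]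
      simpa [mem_kerFst] using this
    refine ⟨(y, x, h), Subtype.ext ?_⟩
    ext z : 1
    simp [← hp]

lemma card_linearMap :
    Nat.card (C →ₗ[k] A) = Nat.card k ^ (Module.finrank k C * Module.finrank k A) := by
  rw [Module.natCard_eq_pow_finrank (K := k), Module.finrank_linearMap]

end Linear

/-! ### Counting representations -/

section Counting

/-- The order of the group `∏ᵢ GL(Eᵢ)`. -/
def cardGL (k : Type*) [Field k] {V : Type*} (E : V → Type*)
    [∀ i, AddCommGroup (E i)] [∀ i, Module k (E i)] : ℕ :=
  Nat.card (∀ i, E i ≃ₗ[k] E i)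

lemma cardGL_pos (k : Type*) [Field k] {V : Type*} [Finite V] (E : V → Type*)
    [∀ i, AddCommGroup (E i)] [∀ i, Module k (E i)] [∀ i, Finite (E i)] : 0 < cardGL k E := by
  have : Nonempty (∀ i, E i ≃ₗ[k] E i) := ⟨fun i => LinearEquiv.refl k (E i)⟩
  exact Nat.card_pos

variable {V : Type u} [Quiver.{v} V] {k : Type w} [Field k]
variable {E : V → Type w} [∀ i, AddCommGroup (E i)] [∀ i, Module k (E i)]
variable {A : V → Type w} [∀ i, AddCommGroup (A i)] [∀ i, Module k (A i)]
variable {C : V → Type w} [∀ i, AddCommGroup (C i)] [∀ i, Module k (C i)]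

instance [Finite V] [∀ i j : V, Finite (i ⟶ j)] [∀ i, Finite (E i)] : Finite (QRep k E) := by
  unfold QRep
  infer_instance

instance [Finite V] [∀ i j : V, Finite (i ⟶ j)] [∀ i, Finite (E i)] : Fintype (QRep k E) :=
  Fintype.ofFinite _

instance [Finite V] [∀ i, Finite (E i)] [∀ i, Finite (A i)] : Fintype (∀ i, E i ≃ₗ[k] A i) :=
  Fintype.ofFinite _

/-- The block-triangular representation on `C × A` with subrepresentation `N` and quotient `L`. -/
def blockRep (N : QRep k A) (L : QRep k C) (h : ∀ ⦃i j : V⦄, (i ⟶ j) → (C i →ₗ[k] A j)) :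
    QRep k (fun i => C i × A i) :=
  fun _ _ a => (L a ∘ₗ LinearMap.fst k _ _).prod
    (h a ∘ₗ LinearMap.fst k _ _ + N a ∘ₗ LinearMap.snd k _ _)

lemma blockRep_apply (N : QRep k A) (L : QRep k C) (h : ∀ ⦃i j : V⦄, (i ⟶ j) → (C i →ₗ[k] A j))
    {i j : V} (a : i ⟶ j) (x : C i × A i) :
    blockRep N L h a x = (L a x.1, h a x.1 + N a x.2) := rfl

section

variable (g : ∀ i, E i ≃ₗ[k] C i × A i) (N : QRep k A) (L : QRep k C)
  (h : ∀ ⦃i j : V⦄, (i ⟶ j) → (C i →ₗ[k] A j))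

/-- The block-triangular representation, transported to `E`. -/
def blockRepOn : QRep k E := transport (fun i => (g i).symm) (blockRep N L h)

lemma apply_blockRepOn {i j : V} (a : i ⟶ j) (x : E i) :
    g j (blockRepOn g N L h a x) = (L a (g i x).1, h a (g i x).1 + N a (g i x).2) := by
  simp [blockRepOn, transport, blockRep_apply]

/-- The subrepresentation of a block-triangular representation. -/
def blockSub : SubRep (blockRepOn g N L h) where
  space i := kerFst (g i)
  map_mem i j a x hx := by
    rw [mem_kerFst] at hx ⊢
    rw [apply_blockRepOn, hx, map_zero]

/-- The subrepresentation of a block-triangular representation is the given one. -/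
def blockSubIso : RepIso (blockSub g N L h).rep N where
  map i := kerFstEquiv (g i)
  comm i j a x := by
    change (g j (blockRepOn g N L h a x.1)).2 = N a (g i x.1).2
    rw [apply_blockRepOn, mem_kerFst.1 x.2, map_zero, map_zero]
    exact zero_add (N a (g i x.1).2)

/-- The quotient of a block-triangular representation is the given one. -/
def blockQuotIso : RepIso (blockSub g N L h).quot L where
  map i := quotKerFstEquiv (g i)
  comm i j a x := by
    obtain ⟨y, rfl⟩ := Submodule.mkQ_surjective _ x
    change (g j (blockRepOn g N L h a y)).1 = L a (g i y).1
    rw [apply_blockRepOn]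

end

lemma blockRepOn_injective (g : ∀ i, E i ≃ₗ[k] C i × A i) :
    Function.Injective fun t : QRep k A × QRep k C × (∀ ⦃i j : V⦄, (i ⟶ j) → (C i →ₗ[k] A j)) =>
      blockRepOn g t.1 t.2.1 t.2.2 := by
  rintro ⟨N, L, h⟩ ⟨N', L', h'⟩ heq
  have key ⦃i j : V⦄ (a : i ⟶ j) (c : C i) (x : A i) :
      (L a c, h a c + N a x) = (L' a c, h' a c + N' a x) := by
    have h1 := apply_blockRepOn g N L h a ((g i).symm (c, x))
    have h2 := apply_blockRepOn g N' L' h' a ((g i).symm (c, x))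
    simp only [LinearEquiv.apply_symm_apply] at h1 h2
    rw [← h1, ← h2]
    exact congrArg (fun X : QRep k E => g j (X a ((g i).symm (c, x)))) heq
  refine Prod.ext ?_ (Prod.ext ?_ ?_) <;> funext i j a <;> ext x
  · simpa using congrArg Prod.snd (key a 0 x)
  · exact congrArg Prod.fst (key a x 0)
  · simpa using congrArg Prod.snd (key a x 0)

/-- Stability of `U` says that, in the coordinates `g`, the block from A to C vanishes; the other
three blocks are read off. -/
lemma exists_eq_blockRepOn (g : ∀ i, E i ≃ₗ[k] C i × A i) {X : QRep k E} (U : SubRep X)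
    (hU : ∀ i, U.space i = kerFst (g i)) :
    ∃ (N : QRep k A) (L : QRep k C) (h : ∀ ⦃i j : V⦄, (i ⟶ j) → (C i →ₗ[k] A j)),
      blockRepOn g N L h = X := by
  let Y : QRep k (fun i => C i × A i) := transport g X
  have hY ⦃i j : V⦄ (a : i ⟶ j) (y : A i) : (Y a (0, y)).1 = 0 := by
    have := U.map_mem a ((g i).symm (0, y))
    rw [hU, hU, mem_kerFst, mem_kerFst] at this
    exact this (by simp)
  refine ⟨fun i j a => LinearMap.snd k _ _ ∘ₗ Y a ∘ₗ LinearMap.inr k _ _,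
    fun i j a => LinearMap.fst k _ _ ∘ₗ Y a ∘ₗ LinearMap.inl k _ _,
    fun i j a => LinearMap.snd k _ _ ∘ₗ Y a ∘ₗ LinearMap.inl k _ _, ?_⟩
  funext i j a
  ext x
  apply (g j).injective
  rw [apply_blockRepOn]
  have h1 : g j (X a x) = Y a ((g i x).1, 0) + Y a (0, (g i x).2) := by
    rw [← map_add]
    simp [Y, transport]
  refine Prod.ext ?_ ?_
  · simp [h1, hY]
  · simp [h1]

section Card

variable [Fintype V] [∀ i, FiniteDimensional k (E i)] [∀ i, FiniteDimensional k (A i)]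
  [∀ i, FiniteDimensional k (C i)]

/-- The number of families of linear maps `Cᵢ → Aⱼ` indexed by the arrows. -/
lemma card_arrowMaps [∀ i j : V, Fintype (i ⟶ j)] :
    Nat.card (∀ ⦃i j : V⦄, (i ⟶ j) → (C i →ₗ[k] A j)) =
      Nat.card k ^ ∑ i, ∑ j, ∑ _ : i ⟶ j, dimVec k C i * dimVec k A j := by
  change Nat.card (∀ i j : V, (i ⟶ j) → (C i →ₗ[k] A j)) = _
  simp only [Nat.card_pi, card_linearMap, Finset.prod_pow_eq_pow_sum]
  rfl

lemma card_adapted (hE : dimVec k E = dimVec k A + dimVec k C) {X : QRep k E} (U : SubRep X) :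
    Nat.card {g : ∀ i, E i ≃ₗ[k] C i × A i // ∀ i, U.space i = kerFst (g i)} =
      open Classical in
      if U.dim = dimVec k A then
        cardGL k A * cardGL k C * Nat.card k ^ ∑ i, dimVec k A i * dimVec k C i else 0 := by
  have e : {g : ∀ i, E i ≃ₗ[k] C i × A i // ∀ i, U.space i = kerFst (g i)} ≃
      ∀ i, {g : E i ≃ₗ[k] C i × A i // kerFst g = U.space i} :=
    (Equiv.subtypeEquivRight fun g => forall_congr' fun i => eq_comm).trans
      (Equiv.subtypePiEquivPi (p := fun i g => kerFst g = U.space i))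
  rw [Nat.card_congr e, Nat.card_pi]
  split_ifs with h
  · rw [cardGL, cardGL, Nat.card_pi, Nat.card_pi, ← Finset.prod_pow_eq_pow_sum,
      ← Finset.prod_mul_distrib, ← Finset.prod_mul_distrib]
    refine Finset.prod_congr rfl fun i _ => ?_
    rw [card_kerFst_eq (U.space i) (congrFun h i) (congrFun hE i), card_linearMap, dimVec, dimVec,
      mul_comm (Module.finrank k (C i))]
    ring
  · obtain ⟨i, hi⟩ := Function.ne_iff.1 h
    have := isEmpty_kerFst_eq (C := C i) (U.space i) hi
    exact Finset.prod_eq_zero (Finset.mem_univ i) Nat.card_of_isEmpty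

end Card

variable [Fintype V] [∀ i j : V, Fintype (i ⟶ j)] [Finite k]
  [∀ i, Finite (E i)] [∀ i, Finite (A i)] [∀ i, Finite (C i)]

/-- The sum of the coefficients of `f` over all points of a space of representations. -/
def Hall.total (f : Hall k V) (E : V → Type w) [∀ i, AddCommGroup (E i)] [∀ i, Module k (E i)]
    [∀ i, Finite (E i)] : Coeff k :=
  ∑ M : QRep k E, f.eval M

-- For fixed `g`, the pairs (X, U) with `U` adapted to `g` correspond to triples (N, L, h), and the
-- summand does not depend on the off-diagonal block `h`.
open Classical in
lemma Hall.sum_adapted (f f' : Hall k V) (g : ∀ i, E i ≃ₗ[k] C i × A i) :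
    ∑ X : QRep k E, ∑ U : SubRep X,
      (if ∀ i, U.space i = kerFst (g i) then f.eval U.rep * f'.eval U.quot else 0) =
    Nat.card (∀ ⦃i j : V⦄, (i ⟶ j) → (C i →ₗ[k] A j)) * (f.total A * f'.total C) := by
  have : Fintype (∀ ⦃i j : V⦄, (i ⟶ j) → (C i →ₗ[k] A j)) := Fintype.ofFinite _
  rw [← Fintype.sum_sigma' fun (X : QRep k E) (U : SubRep X) =>
    if ∀ i, U.space i = kerFst (g i) then f.eval U.rep * f'.eval U.quot else 0, ← Finset.sum_filter]
  trans ∑ t : QRep k A × QRep k C × (∀ ⦃i j : V⦄, (i ⟶ j) → (C i →ₗ[k] A j)),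
    f.eval t.1 * f'.eval t.2.1
  · symm
    refine Finset.sum_bij (fun t _ => ⟨_, blockSub g t.1 t.2.1 t.2.2⟩) ?_ ?_ ?_ ?_
    · intro t _
      exact Finset.mem_filter.2 ⟨Finset.mem_univ _, fun i => rfl⟩
    · intro t _ t' _ h
      exact blockRepOn_injective g (congrArg Sigma.fst h)
    · rintro ⟨X, U⟩ hU
      have hU := (Finset.mem_filter.1 hU).2
      obtain ⟨N, L, h, rfl⟩ := exists_eq_blockRepOn g U hU
      refine ⟨(N, L, h), Finset.mem_univ _, congrArg (Sigma.mk _) ?_⟩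
      exact SubRep.ext fun i => (hU i).symm
    · intro t _
      exact congrArg₂ (· * ·) (f.eval_congr (blockSubIso g t.1 t.2.1 t.2.2)).symm
        (f'.eval_congr (blockQuotIso g t.1 t.2.1 t.2.2)).symm
  · rw [Hall.total, Hall.total, Finset.sum_mul_sum]
    simp only [Fintype.sum_prod_type, Finset.sum_const, Finset.card_univ, nsmul_eq_mul,
      Nat.card_eq_fintype_card, Finset.mul_sum]

open Classical in
/-- The contribution of the subrepresentations of a given dimension vector. -/
lemma Hall.sum_sub_of_dim (f f' : Hall k V) (hE : dimVec k E = dimVec k A + dimVec k C) :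
    (cardGL k A * cardGL k C * Nat.card k ^ (∑ i, dimVec k A i * dimVec k C i) : Coeff k) *
      ∑ X : QRep k E, ∑ U : SubRep X,
        (if U.dim = dimVec k A then f.eval U.rep * f'.eval U.quot else 0) =
    cardGL k E * Nat.card k ^ (∑ i, ∑ j, ∑ _ : i ⟶ j, dimVec k C i * dimVec k A j) *
      (f.total A * f'.total C) := by
  have e (i : V) : E i ≃ₗ[k] C i × A i := LinearEquiv.ofFinrankEq _ _ <| by
    rw [Module.finrank_prod, add_comm]
    exact congrFun hE i
  have hcard : Nat.card (∀ i, E i ≃ₗ[k] C i × A i) = cardGL k E :=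
    Nat.card_congr (Equiv.piCongrRight fun i =>
      ⟨fun g => g.trans (e i).symm, fun g => g.trans (e i), fun g => by ext <;> simp,
        fun g => by ext; simp⟩)
  -- Double counting of triples (g, X, U) with `U` adapted to `g`: fixing (X, U) gives
  -- `card_adapted`, fixing `g` gives `Hall.sum_adapted`.
  trans ∑ g : ∀ i, E i ≃ₗ[k] C i × A i, ∑ X : QRep k E, ∑ U : SubRep X,
      (if ∀ i, U.space i = kerFst (g i) then f.eval U.rep * f'.eval U.quot else 0)
  · rw [Finset.sum_comm, Finset.mul_sum]
    refine Finset.sum_congr rfl fun X _ => ?_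
    rw [Finset.sum_comm, Finset.mul_sum]
    refine Finset.sum_congr rfl fun U _ => ?_
    rw [← Finset.sum_filter, Finset.sum_const, ← Fintype.card_subtype, ← Nat.card_eq_fintype_card,
      card_adapted hE U]
    split_ifs <;> simp
  · simp only [Hall.sum_adapted, Finset.sum_const, Finset.card_univ, nsmul_eq_mul,
      ← Nat.card_eq_fintype_card, hcard, card_arrowMaps, Nat.cast_pow, mul_assoc]

end Counting

/-! ### The integration map of a hereditary category is multiplicative -/

section EulerForm

variable {V : Type u} [Quiver.{v} V] [Fintype V] [∀ i j : V, Fintype (i ⟶ j)]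

lemma eulerForm_add_left (α β γ : V → ℤ) :
    eulerForm (α + β) γ = eulerForm α γ + eulerForm β γ := by
  simp only [eulerForm, Pi.add_apply, add_mul, Finset.sum_add_distrib]
  ring

lemma eulerForm_add_right (α β γ : V → ℤ) :
    eulerForm α (β + γ) = eulerForm α β + eulerForm α γ := by
  simp only [eulerForm, Pi.add_apply, mul_add, Finset.sum_add_distrib]
  ring

/-- Half of the excess, χ(γ, β), is the power of q that the count of extensions has to cancel. -/
lemma titsForm_add (β γ : V → ℤ) :
    titsForm (β + γ) = skewForm β γ + titsForm β + titsForm γ + 2 * eulerForm γ β := by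
  simp only [titsForm, skewForm, eulerForm_add_left, eulerForm_add_right]
  ring

lemma eulerForm_toInt (β γ : V → ℕ) :
    eulerForm (toInt γ) (toInt β) =
      (∑ i, β i * γ i : ℕ) - (∑ i, ∑ j, ∑ _ : i ⟶ j, γ i * β j : ℕ) := by
  simp [eulerForm, toInt, mul_comm (β _ : ℤ)]

lemma toInt_add {V : Type*} (β γ : V → ℕ) : toInt (β + γ) = toInt β + toInt γ := by
  funext i
  simp [toInt]

end EulerForm

section CoefficientField

lemma sqrtq_sq (k : Type w) : sqrtq k ^ 2 = (Nat.card k : Coeff k) := by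
  apply Subtype.ext
  change (Real.sqrt (Nat.card k : ℝ)) ^ 2 = _
  rw [Real.sq_sqrt (Nat.cast_nonneg _)]
  simp

variable (k : Type w) [Field k] [Finite k]

lemma natCard_ne_zero : (Nat.card k : Coeff k) ≠ 0 :=
  Nat.cast_ne_zero.2 Nat.card_pos.ne'

lemma neg_sqrtq_ne_zero : -sqrtq k ≠ 0 := by
  rw [neg_ne_zero]
  intro h
  apply natCard_ne_zero k
  rw [← sqrtq_sq, h, zero_pow two_ne_zero]

end CoefficientField

/-! ### From isomorphism classes to points of the representation space -/

section Orbits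

variable {V : Type u} [Quiver.{v} V] {k : Type w} [Field k]
variable {E : V → Type w} [∀ i, AddCommGroup (E i)] [∀ i, Module k (E i)]

instance [Finite V] [∀ i, Finite (E i)] (M N : QRep k E) : Finite (RepIso M N) :=
  Finite.of_injective RepIso.map fun _ _ h => RepIso.ext h

/-- Orbit–stabilizer in additive form: each element of ∏ GL(E_i) is an isomorphism from `X` to
exactly one representation, its transport. -/
lemma sum_card_repIso [Finite V] [∀ i j : V, Finite (i ⟶ j)] [∀ i, Finite (E i)] (X : QRep k E) :
    ∑ M : QRep k E, Nat.card (RepIso X M) = cardGL k E := by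
  rw [← Nat.card_sigma]
  refine Nat.card_congr (Equiv.ofBijective (fun t : (M : QRep k E) × RepIso X M => t.2.map) ⟨?_, ?_⟩)
  · rintro ⟨M, g⟩ ⟨M', g'⟩ h
    change g.map = g'.map at h
    obtain rfl : M = M' := by
      funext i j a
      ext x
      obtain ⟨y, rfl⟩ := (g.map i).surjective x
      rw [← g.comm, h, ← g'.comm]
    exact congrArg (Sigma.mk M) (RepIso.ext h)
  · intro g
    exact ⟨⟨transport g X, transportIso g X⟩, rfl⟩

variable {α : V → ℕ}

lemma IsoClass.cardAut_pos [Finite V] [Finite k] (X : IsoClass k α) : 0 < X.cardAut := by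
  have : Nonempty (RepIso X.rep X.rep) := ⟨RepIso.refl _⟩
  exact Nat.card_pos

open Classical in
lemma IsoClass.card_repIso (X : IsoClass k α) (M : RepSpace k α) :
    Nat.card (RepIso X.rep M) = if IsoClass.mk M = X then X.cardAut else 0 := by
  split_ifs with h
  · obtain ⟨g⟩ := (nonempty_repIso_rep_iff (RepIso.refl M) X).2 h.symm
    exact Nat.card_congr ⟨fun f => f.trans g, fun f => f.trans g.symm,
      fun f => by ext i x; simp [RepIso.trans, RepIso.symm],
      fun f => by ext i x; simp [RepIso.trans, RepIso.symm]⟩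
  · have : IsEmpty (RepIso X.rep M) :=
      ⟨fun g => h ((nonempty_repIso_rep_iff (RepIso.refl M) X).1 ⟨g.symm⟩).symm⟩
    exact Nat.card_of_isEmpty

variable [Fintype V] [∀ i j : V, Fintype (i ⟶ j)] [Finite k]

/-- The points of class `X` form an orbit of ∏ GL with stabilizer Aut(X). -/
lemma sum_isoClass_div_cardAut (φ : IsoClass k α → Coeff k) :
    ∑ X : IsoClass k α, φ X / X.cardAut =
      (∑ M : RepSpace k α, φ (IsoClass.mk M)) / cardGL k (fun i => Fin (α i) → k) := by
  classical
  have hGL : (cardGL k (fun i => Fin (α i) → k) : Coeff k) ≠ 0 :=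
    Nat.cast_ne_zero.2 (cardGL_pos k _).ne'
  have key (X : IsoClass k α) :
      ∑ M : RepSpace k α, (if IsoClass.mk M = X then φ X else 0) =
        φ X / X.cardAut * cardGL k (fun i => Fin (α i) → k) := by
    have hX : (X.cardAut : Coeff k) ≠ 0 := Nat.cast_ne_zero.2 X.cardAut_pos.ne'
    rw [← sum_card_repIso X.rep, Nat.cast_sum, Finset.mul_sum]
    refine Finset.sum_congr rfl fun M _ => ?_
    rw [X.card_repIso]
    split_ifs
    · rw [div_mul_cancel₀ _ hX]
    · simp
  rw [eq_div_iff hGL, Finset.sum_mul, ← Finset.sum_congr rfl fun X _ => key X, Finset.sum_comm]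
  simp

/-- The integration map as a sum over representations instead of isomorphism classes. -/
lemma integration_apply (f : Hall k V) (α : V → ℕ) :
    integration f α = (-sqrtq k) ^ titsForm (toInt α) *
      (f.total (fun i => Fin (α i) → k) / cardGL k (fun i => Fin (α i) → k)) := by
  have h := sum_isoClass_div_cardAut (f α)
  simp only [← Hall.eval_mk] at h
  rw [Hall.total, ← h, Finset.mul_sum]
  exact Finset.sum_congr rfl fun X _ => by ring

lemma Hall.total_mul (f g : Hall k V) (α : V → ℕ) :
    (f * g).total (fun i => Fin (α i) → k) = open Classical in
      ∑ β ∈ Finset.Iic α, ∑ X : RepSpace k α, ∑ U : SubRep X,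
        (if U.dim = β then f.eval U.rep * g.eval U.quot else 0) := by
  classical
  rw [Finset.sum_comm, Hall.total]
  refine Finset.sum_congr rfl fun X _ => ?_
  rw [Finset.sum_comm, Hall.eval_mul]
  refine Finset.sum_congr rfl fun U _ => ?_
  rw [Finset.sum_ite_eq, if_pos]
  exact Finset.mem_Iic.2 (U.dim_le.trans_eq (funext fun i => by simp [dimVec]))

/-- The product is compared separately for each dimension vector β of the subrepresentation, where
`Hall.sum_sub_of_dim` gives the count. -/
theorem integration_mul (f g : Hall k V) : integration (f * g) = integration f * integration g := by
  classical
  funext α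
  change _ = ∑ β ∈ Finset.Iic α, (-sqrtq k) ^ skewForm (toInt β) (toInt (α - β)) *
    (integration f β * integration g (α - β))
  simp only [integration_apply]
  rw [Hall.total_mul, Finset.sum_div, Finset.mul_sum]
  refine Finset.sum_congr rfl fun β hβ => ?_
  have hαβ : β + (α - β) = α := add_tsub_cancel_of_le (Finset.mem_Iic.1 hβ)
  generalize α - β = γ at hαβ
  subst hαβ
  have hd (δ : V → ℕ) : dimVec k (fun i => Fin (δ i) → k) = δ := funext fun i => by simp [dimVec]
  have h := Hall.sum_sub_of_dim (E := fun i => Fin ((β + γ) i) → k) (A := fun i => Fin (β i) → k)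
    (C := fun i => Fin (γ i) → k) f g (by simp only [hd])
  simp only [hd] at h
  have hGL (δ : V → ℕ) : (cardGL k (fun i => Fin (δ i) → k) : Coeff k) ≠ 0 :=
    Nat.cast_ne_zero.2 (cardGL_pos k _).ne'
  have hs := neg_sqrtq_ne_zero k
  -- All powers of q become powers of the single base `-sqrtq k`, so that only the identity `hexp`
  -- between exponents remains.
  rw [← sqrtq_sq, ← neg_sq (sqrtq k), ← pow_mul, ← pow_mul] at h
  have hexp : titsForm (toInt (β + γ)) + (2 * (∑ i, ∑ j, ∑ _ : i ⟶ j, γ i * β j) : ℕ) =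
      skewForm (toInt β) (toInt γ) + titsForm (toInt β) + titsForm (toInt γ) +
        (2 * (∑ i, β i * γ i) : ℕ) := by
    rw [toInt_add, titsForm_add, eulerForm_toInt]
    push_cast
    ring
  have hpow := congrArg (fun n : ℤ => (-sqrtq k) ^ n) hexp
  simp only [zpow_add₀ hs, zpow_natCast] at hpow
  have h1 := hGL β
  have h2 := hGL γ
  have h3 := hGL (β + γ)
  have h4 := pow_ne_zero (2 * (∑ i, β i * γ i)) hs
  rw [mul_div_assoc', div_eq_iff h3]
  apply mul_left_cancel₀ (mul_ne_zero (mul_ne_zero h1 h2) h4)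
  rw [mul_left_comm, h]
  field_simp
  linear_combination f.total (fun i => Fin (β i) → k) * g.total (fun i => Fin (γ i) → k) * hpow

end Orbits

/-! ### The trace of the potential -/

section Trace

/-- A retraction r of the inclusion ι and the matching section s of the projection π satisfy ιr + sπ
= 1. Cyclicity of the trace turns tr(rfι) + tr(πfs) into tr(f(ιr + sπ)). -/
lemma trace_eq_trace_sub_add_trace_quot {k : Type*} [Field k] {E : Type*} [AddCommGroup E]
    [Module k E] [FiniteDimensional k E] (U : Submodule k E) {f : E →ₗ[k] E} {fU : U →ₗ[k] U}
    {fQ : (E ⧸ U) →ₗ[k] (E ⧸ U)} (hU : U.subtype ∘ₗ fU = f ∘ₗ U.subtype)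
    (hQ : fQ ∘ₗ U.mkQ = U.mkQ ∘ₗ f) :
    LinearMap.trace k E f = LinearMap.trace k U fU + LinearMap.trace k (E ⧸ U) fQ := by
  obtain ⟨r, hr⟩ := U.subtype.exists_leftInverse_of_injective U.ker_subtype
  let s : (E ⧸ U) →ₗ[k] E := U.liftQ (LinearMap.id - U.subtype ∘ₗ r) fun x hx => by
    have : r x = ⟨x, hx⟩ := LinearMap.congr_fun hr ⟨x, hx⟩
    simp [this]
  have hs : U.mkQ ∘ₗ s = LinearMap.id := by
    ext x
    simp [s]
  have hid : U.subtype ∘ₗ r + s ∘ₗ U.mkQ = LinearMap.id := by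
    ext x
    simp [s]
  have h1 : fU = r ∘ₗ (f ∘ₗ U.subtype) := by
    rw [← hU, ← LinearMap.comp_assoc, hr, LinearMap.id_comp]
  have h2 : fQ = U.mkQ ∘ₗ (f ∘ₗ s) := by
    rw [← LinearMap.comp_assoc, ← hQ, LinearMap.comp_assoc, hs, LinearMap.comp_id]
  rw [h1, h2, LinearMap.trace_comp_comm', LinearMap.trace_comp_comm' (f ∘ₗ s), ← map_add,
    LinearMap.comp_assoc, LinearMap.comp_assoc, ← LinearMap.comp_add, hid, LinearMap.comp_id]

variable {V : Type u} [Quiver.{v} V] {k : Type w} [Field k]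
variable {E : V → Type w} [∀ i, AddCommGroup (E i)] [∀ i, Module k (E i)]

lemma coe_pathMap_rep {M : QRep k E} (U : SubRep M) {i j : V} (p : Quiver.Path i j)
    (x : U.space i) : (pathMap U.rep p x : E j) = pathMap M p x := by
  induction p with
  | nil => rfl
  | cons p a ih => exact congrArg (M a) ih

lemma pathMap_quot_mkQ {M : QRep k E} (U : SubRep M) {i j : V} (p : Quiver.Path i j)
    (x : E i) : pathMap U.quot p ((U.space i).mkQ x) = (U.space j).mkQ (pathMap M p x) := by
  induction p with
  | nil => rfl
  | cons p a ih => exact congrArg (U.quot a) ih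

lemma traceW_sub_add_quot [∀ i, FiniteDimensional k (E i)] (W : Potential k V) {M : QRep k E}
    (U : SubRep M) : traceW W M = traceW W U.rep + traceW W U.quot := by
  simp only [traceW, Finsupp.sum, ← Finset.sum_add_distrib, ← mul_add]
  refine Finset.sum_congr rfl fun u _ => congrArg (W u * ·) ?_
  exact trace_eq_trace_sub_add_trace_quot _ (LinearMap.ext fun x => coe_pathMap_rep U u.path x)
    (LinearMap.ext fun x => pathMap_quot_mkQ U u.path x)

lemma pathMap_scale (wt : Arrow V → ℕ) (t : kˣ) (M : QRep k E) {i j : V} (p : Quiver.Path i j) :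
    pathMap (scale wt t M) p = (t : k) ^ pathWeight wt p • pathMap M p := by
  induction p with
  | nil => simp [pathMap, pathWeight]
  | cons p a ih =>
    simp only [pathMap, ih, pathWeight, scale, LinearMap.smul_comp, LinearMap.comp_smul, smul_smul,
      pow_add]

/-- Only a common value `s` of the powers is needed, which covers both a homogeneous weight and the
weight of `IsPrimitive.exists_weight`. -/
lemma traceW_scale (W : Potential k V) (wt : Arrow V → ℕ) {s t : kˣ}
    (h : ∀ u ∈ W.support, t ^ pathWeight wt u.path = s) (M : QRep k E) :
    traceW W (scale wt t M) = s * traceW W M := by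
  simp only [traceW, Finsupp.sum, Finset.mul_sum]
  refine Finset.sum_congr rfl fun u hu => ?_
  rw [pathMap_scale, map_smul, ← h u hu, smul_eq_mul, Units.val_pow_eq_pow_val]
  ring

/-- A primitive potential is homogeneous of weight `1` with respect to some integral weight; over a
finite field the weight can be taken to be nonnegative. -/
lemma IsPrimitive.exists_weight [Finite k] {W : Potential k V} (h : IsPrimitive W) :
    ∃ wt : Arrow V → ℕ, ∀ (t : kˣ), ∀ u ∈ W.support, t ^ pathWeight wt u.path = t := by
  obtain ⟨ρ, hρ⟩ := h
  let n : (Arrow V →₀ ℤ) →+ ℤ := ρ.comp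
    ((QuotientAddGroup.mk' (pushoutRelations W)).comp (AddMonoidHom.inl _ _))
  -- The retraction kills (content u, -1) and sends (0, 1) to 1.
  have hn : ∀ u ∈ W.support, n (content u.path) = 1 := by
    intro u hu
    have h0 : ρ (QuotientAddGroup.mk' (pushoutRelations W) (content u.path, -1)) = 0 := by
      refine (congrArg ρ ((QuotientAddGroup.eq_zero_iff _).2 ?_)).trans (map_zero ρ)
      exact AddSubgroup.subset_closure ⟨u, hu, rfl⟩
    have h1 : ρ (QuotientAddGroup.mk' (pushoutRelations W) (0, 1)) = 1 := DFunLike.congr_fun hρ 1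
    rw [show (content u.path, (-1 : ℤ)) = (content u.path, 0) - (0, 1) by simp, map_sub, map_sub,
      h1] at h0
    exact sub_eq_zero.1 h0
  have hq : (0 : ℤ) < Nat.card kˣ := Nat.cast_pos.2 Nat.card_pos
  -- Exponents of elements of k^* matter only modulo its order, so residues make the weights
  -- nonnegative.
  refine ⟨fun a => (n (Finsupp.single a 1) % Nat.card kˣ).toNat, fun t u hu => ?_⟩
  have key {i j : V} (p : Quiver.Path i j) :
      (pathWeight (fun a => (n (Finsupp.single a 1) % Nat.card kˣ).toNat) p : ℤ) ≡
        n (content p) [ZMOD Nat.card kˣ] := by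
    induction p with
    | nil => simp [pathWeight, content]
    | cons p a ih =>
      simp only [pathWeight, content, map_add, Nat.cast_add]
      refine ih.add ?_
      rw [Int.toNat_of_nonneg (Int.emod_nonneg _ hq.ne')]
      exact Int.mod_modEq _ _
  have h2 := (key u.path).of_dvd (Int.natCast_dvd_natCast.2 (orderOf_dvd_natCard t))
  rw [hn u hu] at h2
  simpa using zpow_eq_zpow_iff_modEq.2 h2

end Trace

/-! ### The equivariant integration map -/

section Equivariant

/-- Each function is a constant plus a multiple of the delta function at 0. Their convolution is a
constant plus the product of the two multiples times delta, and the difference of values at 0 and 1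
reads off that coefficient. -/
lemma sum_mul_sub_sum_mul {k K : Type*} [Fintype k] [Field k] [Field K] {a b : k → K}
    (ha : ∀ c, c ≠ 0 → a c = a 1) (hb : ∀ c, c ≠ 0 → b c = b 1) :
    ∑ c, a c * b (0 - c) - ∑ c, a c * b (1 - c) = (a 0 - a 1) * (b 0 - b 1) := by
  classical
  have h (d : k) : ∑ c, a c * b (d - c) =
      Fintype.card k * (a 1 * b 1) + (a 0 - a 1) * b 1 + a 1 * (b 0 - b 1) +
        if d = 0 then (a 0 - a 1) * (b 0 - b 1) else 0 := by
    have key (c : k) : a c * b (d - c) = a 1 * b 1 + (if c = 0 then (a 0 - a 1) * b 1 else 0) +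
        (if c = d then a 1 * (b 0 - b 1) else 0) +
        (if c = 0 then if d = 0 then (a 0 - a 1) * (b 0 - b 1) else 0 else 0) := by
      have hb' : b (d - c) = b 1 + if c = d then b 0 - b 1 else 0 := by
        split_ifs with hc
        · simp [hc]
        · simp [hb _ (sub_ne_zero.2 (Ne.symm hc))]
      rw [hb']
      by_cases hc : c = 0
      · subst hc
        simp only [if_true, eq_comm (a := d)]
        split_ifs <;> ring
      · simp only [ha c hc, hc, if_false]
        split_ifs <;> ring
    rw [Finset.sum_congr rfl fun c _ => key c]
    simp only [Finset.sum_add_distrib, Finset.sum_ite_eq', Finset.mem_univ, if_true,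
      Finset.sum_const, Finset.card_univ, nsmul_eq_mul]
  rw [h, h]
  simp

variable {V : Type u} [Quiver.{v} V] {k : Type w} [Field k]
variable {E : V → Type w} [∀ i, AddCommGroup (E i)] [∀ i, Module k (E i)]

open Classical in
/-- The part of `f` supported on the representations with `w(M) = c`. -/
def Hall.part (W : Potential k V) (c : k) (f : Hall k V) : Hall k V :=
  fun _ M => if M.w W = c then f _ M else 0

open Classical in
lemma Hall.eval_part [∀ i, FiniteDimensional k (E i)] (W : Potential k V) (c : k) (f : Hall k V)
    (M : QRep k E) : (f.part W c).eval M = if traceW W M = c then f.eval M else 0 := by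
  have h : (isoClass M).w W = traceW W M := by
    obtain ⟨g⟩ := (exists_repSpace M fun _ => rfl).choose_spec
    exact (traceW_congr W g).symm
  rw [← h]
  rfl

lemma mem_hallEq_iff {wt : Arrow V → ℕ} {f : Hall k V} :
    f ∈ HallEq k wt ↔
      ∀ (t : kˣ) (α : V → ℕ) (M : RepSpace k α), f.eval (scale wt t M) = f.eval M := by
  simp only [Hall.eval_mk]
  exact forall_congr' fun t => forall_congr' fun α =>
    ⟨fun h M => h (IsoClass.mk M), fun h X => X.mk_rep ▸ h X.rep⟩

lemma Hall.eval_scale [∀ i, FiniteDimensional k (E i)] {wt : Arrow V → ℕ} {f : Hall k V}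
    (hf : f ∈ HallEq k wt) (t : kˣ) (M : QRep k E) : f.eval (scale wt t M) = f.eval M := by
  obtain ⟨X, ⟨g⟩⟩ := exists_repSpace M fun _ => rfl
  rw [f.eval_congr g, f.eval_congr (g.scale wt t)]
  exact mem_hallEq_iff.1 hf t _ X

/-- The representations `M` and `tM` have the same subspaces as subrepresentations. -/
def SubRep.scaleEquiv (wt : Arrow V → ℕ) (t : kˣ) (M : QRep k E) :
    SubRep M ≃ SubRep (scale wt t M) where
  toFun U := ⟨U.space, fun _ _ a x hx => Submodule.smul_mem _ _ (U.map_mem a x hx)⟩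
  invFun U := ⟨U.space, fun _ _ a x hx =>
    (Submodule.smul_mem_iff _ (pow_ne_zero _ t.ne_zero)).1 (U.map_mem a x hx)⟩
  left_inv _ := rfl
  right_inv _ := rfl

/-- The action of `t ∈ k^*` on a space of representations. -/
def scaleEquiv (wt : Arrow V → ℕ) (t : kˣ) : QRep k E ≃ QRep k E where
  toFun := scale wt t
  invFun := scale wt t⁻¹
  left_inv M := by
    funext i j a
    simp [scale, smul_smul]
  right_inv M := by
    funext i j a
    simp [scale, smul_smul]

lemma one_mem_hallEq [Fintype V] (wt : Arrow V → ℕ) : (1 : Hall k V) ∈ HallEq k wt :=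
  fun _ _ _ => rfl

lemma Hall.part_zero_one [Fintype V] (W : Potential k V) : (1 : Hall k V).part W 0 = 1 := by
  classical
  refine Hall.ext_eval fun α M => ?_
  rw [Hall.eval_part, Hall.eval_one]
  simp only [Module.finrank_fin_fun]
  split_ifs with h1 h2 h2 <;> try rfl
  refine absurd ?_ h1
  refine Finset.sum_eq_zero fun u _ => ?_
  have : IsEmpty (Fin (α u.base)) := by
    rw [h2]
    infer_instance
  dsimp only
  rw [Subsingleton.elim (pathMap M u.path) 0, map_zero, mul_zero]

variable [Fintype V] [∀ i j : V, Fintype (i ⟶ j)] [Finite k]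

/-- `M` and `tM` have the same stable subspaces, and scaling commutes with passing to
subrepresentations and quotients. -/
lemma mul_mem_hallEq {wt : Arrow V → ℕ} {f g : Hall k V} (hf : f ∈ HallEq k wt)
    (hg : g ∈ HallEq k wt) : f * g ∈ HallEq k wt := by
  rw [mem_hallEq_iff]
  intro t α M
  rw [Hall.eval_mul, Hall.eval_mul, ← Equiv.sum_comp (SubRep.scaleEquiv wt t M)]
  congr 1; funext U
  refine congrArg₂ (· * ·) (Hall.eval_scale hf t U.rep) (Eq.trans ?_ (Hall.eval_scale hg t U.quot))
  refine congrArg g.eval ?_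
  funext i j a
  ext x
  rfl

lemma integration_eq_sum {ι : Type*} [Fintype ι] {f : Hall k V} {F : ι → Hall k V} {α : V → ℕ}
    (h : ∀ M : RepSpace k α, f.eval M = ∑ c, (F c).eval M) :
    integration f α = ∑ c, integration (F c) α := by
  simp only [integration_apply, Hall.total, h]
  rw [Finset.sum_comm, Finset.sum_div, Finset.mul_sum]

lemma integration_eq_sum_part [Fintype k] (W : Potential k V) (f : Hall k V) (α : V → ℕ) :
    integration f α = ∑ c, integration (f.part W c) α := by
  classical
  refine integration_eq_sum fun M => ?_
  simp only [Hall.eval_part]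
  rw [Finset.sum_ite_eq, if_pos (Finset.mem_univ _)]

/-- Since w is additive, a subrepresentation with w = b in a representation with w = c has a
quotient with w = c - b. -/
lemma integration_part_mul [Fintype k] (W : Potential k V) (f g : Hall k V) (c : k) (α : V → ℕ) :
    integration ((f * g).part W c) α =
      ∑ b, integration (f.part W b * g.part W (c - b)) α := by
  classical
  refine integration_eq_sum fun M => ?_
  simp only [Hall.eval_mul, Hall.eval_part]
  rw [Finset.sum_comm]
  split_ifs with h
  · refine Finset.sum_congr rfl fun U _ => ?_
    rw [Finset.sum_eq_single (traceW W U.rep), if_pos rfl, if_pos]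
    · rw [← h, traceW_sub_add_quot W U, add_sub_cancel_left]
    · intro b _ hb
      rw [if_neg hb.symm, zero_mul]
    · simp
  · refine (Finset.sum_eq_zero fun U _ => Finset.sum_eq_zero fun b _ => ?_).symm
    rw [traceW_sub_add_quot W U] at h
    dsimp only
    split_ifs with h1 h2
    · exact absurd (by rw [h1, h2]; ring) h
    all_goals simp

/-- With `t` chosen for `s = c`, the map M ↦ tM carries the locus w = 1 bijectively onto w = c and
preserves the coefficients of `f`. -/
lemma integration_part_eq {W : Potential k V} {wt : Arrow V → ℕ}
    (hW : ∀ s : kˣ, ∃ t : kˣ, ∀ u ∈ W.support, t ^ pathWeight wt u.path = s) {f : Hall k V}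
    (hf : f ∈ HallEq k wt) {c : k} (hc : c ≠ 0) :
    integration (f.part W c) = integration (f.part W 1) := by
  classical
  funext α
  rw [integration_apply, integration_apply, Hall.total, Hall.total]
  obtain ⟨t, ht⟩ := hW (Units.mk0 c hc)
  rw [← Equiv.sum_comp (scaleEquiv wt t)]
  congr 3
  funext M
  change (f.part W c).eval (scale wt t M) = _
  rw [Hall.eval_part, Hall.eval_part, Hall.eval_scale hf, traceW_scale W wt ht, Units.val_mk0]
  simp only [mul_eq_left₀ hc]

lemma eqIntegration_apply (W : Potential k V) (wt : Arrow V → ℕ) (f : HallEq k wt) (α : V → ℕ) :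
    eqIntegration W wt f α = (1 - (Nat.card k : Coeff k))⁻¹ *
      (integration (f : Hall k V) α - Nat.card k * integration ((f : Hall k V).part W 0) α) := rfl

/-- The weight enters only through the domain, never the value; this allows it to be exchanged for
another. -/
lemma eqIntegration_congr (W : Potential k V) (wt wt' : Arrow V → ℕ) {f : HallEq k wt}
    {g : HallEq k wt'} {α : V → ℕ} (h : (f : Hall k V) α = (g : Hall k V) α) :
    eqIntegration W wt f α = eqIntegration W wt' g α := by
  have key {f g : Hall k V} (h : f α = g α) : integration f α = integration g α :=
    Finset.sum_congr rfl fun M _ => congrArg (· * _) (congrFun h M)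
  rw [eqIntegration_apply, eqIntegration_apply, key h,
    key (f := Hall.part W 0 f) (g := Hall.part W 0 g)]
  funext M
  classical exact if_congr Iff.rfl (congrFun h M) rfl

/-- The q - 1 parts with c ≠ 0 integrate equally, so I(f) = I(f_0) + (q - 1) I(f_1). -/
lemma eqIntegration_eq_sub {W : Potential k V} {wt : Arrow V → ℕ}
    (hW : ∀ s : kˣ, ∃ t : kˣ, ∀ u ∈ W.support, t ^ pathWeight wt u.path = s) (f : HallEq k wt)
    (α : V → ℕ) :
    eqIntegration W wt f α =
      integration ((f : Hall k V).part W 0) α - integration ((f : Hall k V).part W 1) α := by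
  classical
  have := Fintype.ofFinite k
  have hq : (Nat.card k : Coeff k) = (Fintype.card k : Coeff k) :=
    congrArg _ Nat.card_eq_fintype_card
  rw [eqIntegration_apply, integration_eq_sum_part W, ← Finset.add_sum_erase _ _ (Finset.mem_univ 0),
    Finset.sum_congr rfl fun c hc =>
      congrFun (integration_part_eq hW f.2 (Finset.ne_of_mem_erase hc)) α,
    Finset.sum_const, Finset.card_erase_of_mem (Finset.mem_univ _), Finset.card_univ,
    hq, nsmul_eq_mul, Nat.cast_sub Fintype.card_pos, Nat.cast_one]
  have h1 : (1 - (Fintype.card k : Coeff k)) ≠ 0 := by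
    rw [sub_ne_zero, Ne, eq_comm, Nat.cast_eq_one]
    exact Fintype.one_lt_card.ne'
  rw [inv_mul_eq_iff_eq_mul₀ h1]
  ring

theorem eqIntegration_mul {W : Potential k V} {wt : Arrow V → ℕ}
    (hW : ∀ s : kˣ, ∃ t : kˣ, ∀ u ∈ W.support, t ^ pathWeight wt u.path = s) (f g : HallEq k wt) :
    eqIntegration W wt ⟨(f : Hall k V) * (g : Hall k V), mul_mem_hallEq f.2 g.2⟩ =
      eqIntegration W wt f * eqIntegration W wt g := by
  classical
  have := Fintype.ofFinite k
  have hmul (a b : QTorus k V) (α : V → ℕ) : (a * b) α = ∑ β ∈ Finset.Iic α,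
    (-sqrtq k) ^ skewForm (toInt β) (toInt (α - β)) * (a β * b (α - β)) := rfl
  funext α
  rw [eqIntegration_eq_sub hW, integration_part_mul, integration_part_mul, hmul]
  simp only [integration_mul, hmul, eqIntegration_eq_sub hW]
  rw [Finset.sum_comm, Finset.sum_comm (s := Finset.univ), ← Finset.sum_sub_distrib]
  refine Finset.sum_congr rfl fun β _ => ?_
  rw [← Finset.mul_sum, ← Finset.mul_sum, ← mul_sub]
  refine congrArg _ (sum_mul_sub_sum_mul
    (a := fun c => integration ((f : Hall k V).part W c) β)
    (b := fun c => integration ((g : Hall k V).part W c) (α - β)) ?_ ?_)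
  · exact fun c hc => congrFun (integration_part_eq hW f.2 hc) β
  · exact fun c hc => congrFun (integration_part_eq hW g.2 hc) (α - β)

lemma integration_one : integration (1 : Hall k V) = 1 := by
  classical
  funext α
  change _ = if α = 0 then 1 else 0
  rw [integration_apply, Hall.total]
  simp only [Hall.eval_one, Module.finrank_fin_fun]
  split_ifs with h h0 h0
  · subst h0
    have (i : V) : IsEmpty (Fin ((0 : V → ℕ) i)) := inferInstanceAs (IsEmpty (Fin 0))
    have h1 : cardGL k (fun i => Fin ((0 : V → ℕ) i) → k) = 1 := by
      rw [cardGL, Nat.card_pi]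
      exact Finset.prod_eq_one fun i _ => Nat.card_unique
    have h2 : Fintype.card (RepSpace k (0 : V → ℕ)) = 1 :=
      Fintype.card_eq_one_iff.2 ⟨fun _ _ _ => 0, fun M => by
        funext i j a
        exact Subsingleton.elim _ _⟩
    have h3 : titsForm (toInt (0 : V → ℕ)) = 0 := by simp [titsForm, eulerForm, toInt]
    rw [h1, h3, Finset.sum_const, Finset.card_univ, h2]
    simp
  · exact absurd (funext h) h0
  · exact absurd (fun i => congrFun h0 i) h
  · simp

theorem eqIntegration_one {W : Potential k V} {wt : Arrow V → ℕ} :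
    eqIntegration W wt ⟨1, one_mem_hallEq wt⟩ = 1 := by
  funext α
  rw [eqIntegration_apply, Hall.part_zero_one, integration_one, ← one_sub_mul,
    inv_mul_cancel_left₀]
  rw [sub_ne_zero, Ne, eq_comm, Nat.cast_eq_one]
  exact Finite.one_lt_card.ne'

/-- `HallEq` is only a submodule without a product of its own, so membership and value are obtained
together. -/
lemma eqIntegration_prod {W : Potential k V} {wt : Arrow V → ℕ}
    (hW : ∀ s : kˣ, ∃ t : kˣ, ∀ u ∈ W.support, t ^ pathWeight wt u.path = s) (f : ℝ → HallEq k wt)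
    (L : List ℝ) :
    ∃ h : (L.map fun μ => (f μ : Hall k V)).prod ∈ HallEq k wt,
      eqIntegration W wt ⟨_, h⟩ = (L.map fun μ => eqIntegration W wt (f μ)).prod := by
  induction L with
  | nil => exact ⟨one_mem_hallEq wt, eqIntegration_one⟩
  | cons μ L ih =>
    obtain ⟨h, ih⟩ := ih
    refine ⟨mul_mem_hallEq (f μ).2 h, ?_⟩
    exact (eqIntegration_mul hW (f μ) ⟨_, h⟩).trans (by rw [ih, List.map_cons, List.prod_cons])

theorem hasDecreasingProd_dtSeries {W : Potential k V} (hprim : IsPrimitive W) (wt : Arrow V → ℕ)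
    (θ : V → ℝ) :
    HasDecreasingProd QTorus.coeff (fun μ => dtSeries W wt θ μ) (dtSeries W wt 0 0) := by
  obtain ⟨wt', h⟩ := hprim.exists_weight
  intro α
  refine (hasDecreasingProd_hallSeries (k := k) θ α).mono fun S hS => ?_
  obtain ⟨hmem, heq⟩ := eqIntegration_prod (W := W) (fun s => ⟨s, h s⟩) (hallSeriesEq wt' θ)
    (S.sort (· ≥ ·))
  change (decreasingProd (fun μ => dtSeries W wt θ μ) S) α = _
  -- `heq` concerns the weight `wt'`; the two series agree definitionally because the value of I_eq
  -- ignores the weight.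
  have h1 : decreasingProd (fun μ => dtSeries W wt θ μ) S = _ := heq.symm
  rw [h1]
  exact eqIntegration_congr W wt' wt hS

end Equivariant

end QuiverDT

end

theorem mainTheorem1 {V : Type u} [Quiver.{v} V] [Fintype V] [∀ i j : V, Fintype (i ⟶ j)]
    {k : Type w} [Field k] [Finite k]
    (W : QuiverDT.Potential k V) (wt : QuiverDT.Arrow V → ℕ) (d : ℕ)
    (hpos : QuiverDT.PositiveOnCycles wt)
    (hhom : QuiverDT.IsHomogeneous W wt d)
    (hprim : QuiverDT.IsPrimitive W)
    (θ : V → ℝ) :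
    -- the Harder–Narasimhan relation in the quantum torus
    QuiverDT.HasDecreasingProd QuiverDT.QTorus.coeff
      (fun μ => QuiverDT.dtSeries W wt θ μ) (QuiverDT.dtSeries W wt 0 0) ∧
    -- the Harder–Narasimhan identity in the completed equivariant Hall algebra
    QuiverDT.HasDecreasingProd QuiverDT.Hall.component
      (fun μ => ((QuiverDT.hallSeriesEq wt θ μ : QuiverDT.HallEq k wt) : QuiverDT.Hall k V))
      ((QuiverDT.hallSeriesEq wt 0 0 : QuiverDT.HallEq k wt) : QuiverDT.Hall k V) ∧
    -- the integration map is a homomorphism of algebras, if `d` is prime to `q - 1`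
    (d.Coprime (Nat.card k - 1) →
      (∃ h : (1 : QuiverDT.Hall k V) ∈ QuiverDT.HallEq k wt,
        QuiverDT.eqIntegration W wt ⟨1, h⟩ = 1) ∧
      ∀ f g : QuiverDT.HallEq k wt,
        ∃ h : (f : QuiverDT.Hall k V) * (g : QuiverDT.Hall k V) ∈ QuiverDT.HallEq k wt,
          QuiverDT.eqIntegration W wt ⟨(f : QuiverDT.Hall k V) * (g : QuiverDT.Hall k V), h⟩ =
            QuiverDT.eqIntegration W wt f * QuiverDT.eqIntegration W wt g) := by
  refine ⟨QuiverDT.hasDecreasingProd_dtSeries hprim wt θ,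
    QuiverDT.hasDecreasingProd_hallSeries θ, fun hd => ?_⟩
  -- The group k^* has order q - 1, prime to d, so the d-th power map is a bijection.
  have hW (s : kˣ) : ∃ t : kˣ, ∀ u ∈ W.support, t ^ QuiverDT.pathWeight wt u.path = s := by
    have hcop : (Nat.card kˣ).Coprime d := by
      rw [Nat.card_units]
      exact hd.symm
    obtain ⟨t, ht⟩ := (powCoprime hcop).surjective s
    exact ⟨t, fun u hu => by rw [hhom u hu, ← ht, powCoprime_apply]⟩
  exact ⟨⟨QuiverDT.one_mem_hallEq wt, QuiverDT.eqIntegration_one⟩,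
    fun f g => ⟨QuiverDT.mul_mem_hallEq f.2 g.2, QuiverDT.eqIntegration_mul hW f g⟩⟩
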